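/- Let $\mathbb F=\mathbb F_q$ be a finite field with $q$ elements, $A=\mathbb F[T]$, $K_\infty=\mathbb F((1/T))$ with its absolute value normalized by $|T|=q$, and let $C_\infty$ be the completion of an algebraic closure of $K_\infty$. Let $r\ge 2$ and let $$\Omega^r=\{(\omega_1:\cdots:\omega_r)\in\mathbb P^{r-1}(C_\infty)\mid \omega_1,\dots,\omega_r \text{ are } K_\infty\text{-linearly independent}\}.$$ For (homogeneous coordinates $(\omega_1,\dots,\omega_r)$ of) a point $\omega\in\Omega^r$ put $\Lambda_\omega=A\omega_1+\cdots+A\omega_r\subset C_\infty$. For $k\ge 1$ let $$E_k(\omega)=\sum_{0\ne\lambda\in\Lambda_\omega}\lambda^{-k}$$ be the Eisenstein series of weight $k$, and put $E_0(\omega)=-1$. Let the para-Eisenstein series $\alpha_i(\omega)$ $(i\ge 0)$ be the coefficients of the exponential function of $\Lambda_\omega$: $$e_{\Lambda_\omega}(z)=z\prod_{0\ne\lambda\in\Lambda_\omega}\Bigl(1-\frac z\lambda\Bigr)=\sum_{i\ge 0}\alpha_i(\omega)\,z^{q^i}\qquad(z\in C_\infty).$$ **Proposition 3.3.** Let $S=\{m,m+1,\dots,m+r-1\}$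 be a set of $r$ consecutive natural numbers ($m\ge 0$) and let $\omega\in\Omega^r$. Then, for any choice of homogeneous coordinates of $\omega$, at least one of the $E_{q^i-1}(\omega)$ with $i\in S$ is nonzero, and at least one of the $\alpha_i(\omega)$ with $i\in S$ is nonzero. -/

import Mathlib

noncomputable section

open scoped NNReal Polynomial LaurentSeries LinearAlgebra.Projectivization

namespace DrinfeldModular

section Fields

variable (F : Type*) [Field F]

/-- The field `K_∞ = F((1/T))` of formal Laurent series over `F` in the variable `1/T`. It carries
the discrete valuation with uniformizer `1/T`, for which it is complete. -/
abbrev KInfty := F⸨X⸩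

/-- The element `T` of `K_∞ = F((1/T))`, i.e. the inverse of the Laurent series variable `1/T`. -/
def elemT : KInfty F := HahnSeries.single (-1 : ℤ) (1 : F)

/-- The embedding of `A = F[T]` into `K_∞ = F((1/T))`, with `T` going to `T` (and so not to the
Laurent series variable). -/
def polyToKInfty : F[X] →+* KInfty F := Polynomial.eval₂RingHom HahnSeries.C (elemT F)

variable [Fintype F]

theorem one_lt_card : (1 : ℝ≥0) < Fintype.card F := by
  exact_mod_cast Fintype.one_lt_card

instance isNontrivial :
    (Valued.v : Valuation (KInfty F) (WithZero (Multiplicative ℤ))).IsNontrivial where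
  exists_val_nontrivial := by
    refine ⟨elemT F, ?_, ?_⟩ <;> rw [elemT, LaurentSeries.valuation_single_zpow] <;> simp

instance rankOne : (Valued.v : Valuation (KInfty F) (WithZero (Multiplicative ℤ))).RankOne :=
  Valuation.IsRankOneDiscrete.rankOne _ (one_lt_card F)

/-- `K_∞` with the absolute value attached to its valuation, normalized by `|T| = q = #F`. -/
instance normedKInfty : NontriviallyNormedField (KInfty F) :=
  Valued.toNontriviallyNormedField (KInfty F) (WithZero (Multiplicative ℤ))

theorem norm_eq (x : KInfty F) :
    ‖x‖ = WithZeroMulInt.toNNReal (one_lt_card F).ne_zero (Valued.v x) := by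
  rw [← Valuation.IsRankOneDiscrete.valueGroup₀_equiv_withZeroMulInt_restrict_apply_of_surjective
    (LaurentSeries.valuation_surjective F) x]
  rfl

theorem norm_elemT : ‖elemT F‖ = Fintype.card F := by
  rw [norm_eq, elemT, LaurentSeries.valuation_single_zpow,
    WithZeroMulInt.toNNReal_neg_apply _ WithZero.exp_ne_zero]
  have : WithZero.unzero (WithZero.exp_ne_zero (a := - (-1 : ℤ))) = Multiplicative.ofAdd 1 := rfl
  rw [this]
  simp

/-- An algebraic closure of `K_∞`. -/
abbrev KInftyAlgCl := AlgebraicClosure (KInfty F)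

/-- The unique extension of the absolute value of `K_∞` to its algebraic closure. -/
instance normedKInftyAlgCl : NontriviallyNormedField (KInftyAlgCl F) :=
  spectralNorm.nontriviallyNormedField (KInfty F) (KInftyAlgCl F)

instance normedAlgebraKInftyAlgCl : NormedAlgebra (KInfty F) (KInftyAlgCl F) :=
  spectralNorm.normedAlgebra (KInfty F) (KInftyAlgCl F)

instance uniformContinuousConstSMulKInftyAlgCl :
    UniformContinuousConstSMul (KInfty F) (KInftyAlgCl F) :=
  uniformContinuousConstSMul_of_continuousConstSMul _ _

/-- The field `C_∞`: the completion of an algebraic closure of `K_∞`. -/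
abbrev CInfty := UniformSpace.Completion (KInftyAlgCl F)

instance normedCInfty : NontriviallyNormedField (CInfty F) where
  non_trivial := by
    obtain ⟨x, hx⟩ := NontriviallyNormedField.non_trivial (α := KInfty F)
    exact ⟨algebraMap (KInfty F) (CInfty F) x, by simpa using hx⟩

/-- The embedding of `A = F[T]` into `C_∞`. -/
def polyToCInfty : F[X] →+* CInfty F := (algebraMap (KInfty F) (CInfty F)).comp (polyToKInfty F)

end Fields

variable {F : Type*} [Field F] [Fintype F] {r : ℕ}

variable (F r) in
/-- The Drinfeld symmetric space `Ω^r`: the points `(ω₁ : ⋯ : ω_r)` of `ℙ^{r-1}(C_∞)` whose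
coordinates are linearly independent over `K_∞`. -/
def Omega : Set (ℙ (CInfty F) (Fin r → CInfty F)) :=
  {P | LinearIndependent (KInfty F) P.rep}

/-- Membership in `Ω^r` can be tested on any vector of homogeneous coordinates. -/
theorem mk_mem_Omega_iff (ω : Fin r → CInfty F) (h : ω ≠ 0) :
    Projectivization.mk (CInfty F) ω h ∈ Omega F r ↔ LinearIndependent (KInfty F) ω := by
  obtain ⟨a, ha⟩ := Projectivization.exists_smul_eq_mk_rep (CInfty F) ω h
  change LinearIndependent (KInfty F) (Projectivization.mk (CInfty F) ω h).rep ↔ _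
  rw [← ha, Fintype.linearIndependent_iff, Fintype.linearIndependent_iff]
  refine forall_congr' fun g => imp_congr_left ?_
  have : ∑ i, g i • (a • ω) i = (a : CInfty F) * ∑ i, g i • ω i := by
    rw [Finset.mul_sum]
    refine Finset.sum_congr rfl fun i _ => ?_
    rw [Pi.smul_apply, Units.smul_def, smul_eq_mul, mul_smul_comm]
  rw [this, mul_eq_zero, or_iff_right a.ne_zero]

/-- The lattice `Λ_ω = A ω₁ + ⋯ + A ω_r` in `C_∞`. -/
def lattice (ω : Fin r → CInfty F) : Set (CInfty F) :=
  Set.range fun a : Fin r → F[X] => ∑ j, polyToCInfty F (a j) * ω j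

/-- The Eisenstein series `E_k(ω) = ∑_{0 ≠ λ ∈ Λ_ω} λ^{-k}` of weight `k > 0`, with the usual
convention `E_0 = -1`. -/
def eisenstein (k : ℕ) (ω : Fin r → CInfty F) : CInfty F :=
  if k = 0 then -1 else ∑' l : {l : CInfty F // l ∈ lattice ω ∧ l ≠ 0}, (l.1 ^ k)⁻¹

/-- The exponential function `e_Λ(z) = z ∏_{0 ≠ λ ∈ Λ} (1 - z / λ)` of the lattice `Λ = Λ_ω`. -/
def latticeExp (ω : Fin r → CInfty F) (z : CInfty F) : CInfty F :=
  z * ∏' l : {l : CInfty F // l ∈ lattice ω ∧ l ≠ 0}, (1 - z / l.1)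

/-- `e_Λ(z) = ∑_{i ≥ 0} a_i z^{q^i}` for all `z` in `C_∞`, where `Λ = Λ_ω`. -/
def IsExpExpansion (ω : Fin r → CInfty F) (a : ℕ → CInfty F) : Prop :=
  ∀ z : CInfty F, HasSum (fun i => a i * z ^ Fintype.card F ^ i) (latticeExp ω z)

/-- The coefficients in such an expansion are unique. -/
theorem IsExpExpansion.unique {ω : Fin r → CInfty F} {a b : ℕ → CInfty F}
    (ha : IsExpExpansion ω a) (hb : IsExpExpansion ω b) : a = b := by
  have hinj : Function.Injective fun i : ℕ => Fintype.card F ^ i :=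
    Nat.pow_right_injective Fintype.one_lt_card
  let c : ℕ → CInfty F := Function.extend (fun i : ℕ => Fintype.card F ^ i) (a - b) 0
  have hs : ∀ z : CInfty F, HasSum (fun n => z ^ n • c n) 0 := by
    intro z
    have h := (ha z).sub (hb z)
    rw [sub_self] at h
    refine (hinj.hasSum_iff ?_).1 (h.congr_fun ?_)
    · intro n hn
      simp [c, Function.extend_apply' _ _ _ (fun ⟨i, hi⟩ => hn ⟨i, hi⟩)]
    · intro i
      simp only [Function.comp, c, hinj.extend_apply, Pi.sub_apply, smul_eq_mul]
      ring
  have hp : HasFPowerSeriesAt (fun _ : CInfty F => (0 : CInfty F))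
      (FormalMultilinearSeries.ofScalars (CInfty F) c) 0 := by
    rw [hasFPowerSeriesAt_iff]
    exact Filter.Eventually.of_forall fun z => by
      simpa only [FormalMultilinearSeries.coeff_ofScalars] using hs z
  have hc : c = 0 := (FormalMultilinearSeries.ofScalars_series_eq_zero _).1 hp.eq_zero
  funext i
  have := congrFun hc (Fintype.card F ^ i)
  simp only [c, hinj.extend_apply, Pi.sub_apply, Pi.zero_apply] at this
  exact sub_eq_zero.1 this

open Classical in
/-- The para-Eisenstein series `α_i(ω)`: the coefficients in the expansion
`e_Λ(z) = ∑_{i ≥ 0} α_i(ω) z^{q^i}`, where `Λ = Λ_ω`. (The value `0` is a placeholder for those `ω`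
whose exponential function has no such expansion.) -/
def paraEisenstein (i : ℕ) (ω : Fin r → CInfty F) : CInfty F :=
  if h : ∃ a, IsExpExpansion ω a then h.choose i else 0

end DrinfeldModular

end

/-! Write Λ for the lattice, t for the image of T, and V_n for the finite F-space of sums ∑ a_j(t)
ω_j with deg a_j < n. The lattice t⁻¹Λ contains Λ with index q^r, so its exponential t⁻¹ e_Λ(tz) is
γ(e_Λ(z)) for a q-linear polynomial γ of degree q^r; φ = tγ is the rank r Drinfeld module of Λ.
Comparing coefficients, t^(q^k - 1) α_k = ∑_{i ≤ r} γ_i α_{k-i}^(q^i). If α_{m+1}, …, α_{m+r}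
vanish, then k = m + r leaves γ_r α_m^(q^r) = 0, so α_m = 0. Descending contradicts α_0 = 1.

For the Eisenstein series, e_Λ' = 1 and logarithmic differentiation give e_Λ(z) ∑_{λ ≠ 0} (1 -
z/λ)⁻¹ = -z. With ε_i = E_{q^i - 1} this says αε = -1 as twisted power series (finite form:
`sum_coeff_mul_powerSum_pow`). Hence -ε is the logarithm, αt = φα becomes tε = εφ, and the same
descent runs down to ε_0 = -1.

The identities are proved for the V_n and passed to the limit. The space t⁻¹V_{n+1} is V_n plus r
independent vectors, so `exists_coeff_sup_span` gives a q-linear g_n with e_{t⁻¹V_{n+1}} = g_n ∘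
e_{V_n}. The coefficients of e_{V_n} converge (`exists_exp_coeff`), hence so do those of g_n
(`exists_tendsto_of_twistedMul`). A lower bound on the top coefficient of g_n, uniform in n, gives
γ_r ≠ 0. Convergence rests on the discreteness of Λ, `finite_lattice_norm_le`. -/

noncomputable section

namespace DrinfeldModular

/-! ### Exponential polynomials of finite F-subspaces -/

section FiniteSubspaces

open Finset Polynomial
open scoped Classical

/-- The polynomial `X ∏ (1 - X / v)`, with `v` running over the nonzero elements of `s`. -/
def expPoly {C : Type*} [Field C] (s : Finset C) : C[X] :=
  X * ∏ v ∈ s.erase 0, (1 - Polynomial.C v⁻¹ * X)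

section Field

variable {C : Type*} [Field C]

theorem coeff_zero_prod_one_sub {ι : Type*} (s : Finset ι) (u : ι → C) :
    (∏ i ∈ s, (1 - Polynomial.C (u i) * X)).coeff 0 = 1 := by
  rw [coeff_zero_eq_eval_zero, eval_prod]
  simp

theorem expPoly_coeff_succ (s : Finset C) (n : ℕ) :
    (expPoly s).coeff (n + 1) =
      (∏ v ∈ s.erase 0, (1 - Polynomial.C v⁻¹ * X)).coeff n := by
  rw [expPoly, coeff_X_mul]

theorem expPoly_coeff_one (s : Finset C) : (expPoly s).coeff 1 = 1 := by
  rw [expPoly_coeff_succ s 0, coeff_zero_prod_one_sub]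

theorem expPoly_eval (s : Finset C) (z : C) :
    (expPoly s).eval z = z * ∏ v ∈ s.erase 0, (1 - z / v) := by
  simp only [expPoly, eval_mul, eval_X, eval_prod, eval_sub, eval_one, eval_C]
  congr 1
  exact prod_congr rfl fun v _ => by rw [div_eq_inv_mul]

theorem expPoly_eval_eq_zero_iff {s : Finset C} (h0 : 0 ∈ s) {z : C} :
    (expPoly s).eval z = 0 ↔ z ∈ s := by
  rw [expPoly_eval, mul_eq_zero, prod_eq_zero_iff]
  constructor
  · rintro (rfl | ⟨v, hv, h⟩)
    · exact h0
    · rw [mem_erase] at hv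
      rw [sub_eq_zero, eq_comm, div_eq_one_iff_eq hv.1] at h
      exact h ▸ hv.2
  · intro hz
    by_cases h : z = 0
    · exact Or.inl h
    · exact Or.inr ⟨z, mem_erase.2 ⟨h, hz⟩, by rw [div_self h, sub_self]⟩

theorem expPoly_natDegree_le {s : Finset C} (h0 : 0 ∈ s) : (expPoly s).natDegree ≤ #s := by
  have h : (∏ v ∈ s.erase 0, (1 - Polynomial.C v⁻¹ * X)).natDegree ≤ #(s.erase 0) := by
    refine (natDegree_prod_le _ _).trans ?_
    rw [card_eq_sum_ones]
    refine sum_le_sum fun v _ => ?_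
    compute_degree
  have h1 := card_erase_add_one h0
  refine natDegree_mul_le.trans ?_
  rw [natDegree_X]
  omega

/-- The difference of the two polynomials, divided by X, has degree below `#s` and vanishes on all
of `s`, including 0 because the linear coefficients agree. This uniqueness criterion identifies
every exponential polynomial below. -/
theorem eq_expPoly {s : Finset C} (h0 : 0 ∈ s) {f : C[X]} (hdeg : f.natDegree ≤ #s)
    (hroot : ∀ v ∈ s, f.eval v = 0) (h1 : f.coeff 1 = 1) : f = expPoly s := by
  set g := f - expPoly s with hg
  have hgdeg : g.natDegree ≤ #s := (natDegree_sub_le _ _).trans (max_le hdeg (expPoly_natDegree_le h0))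
  have hgroot : ∀ v ∈ s, g.eval v = 0 := fun v hv => by
    rw [hg, eval_sub, hroot v hv, (expPoly_eval_eq_zero_iff h0).2 hv, sub_zero]
  have hg0 : g.coeff 0 = 0 := by rw [coeff_zero_eq_eval_zero]; exact hgroot 0 h0
  have hg1 : g.coeff 1 = 0 := by rw [hg, coeff_sub, h1, expPoly_coeff_one, sub_self]
  have hX : g.divX * X = g := by
    conv_rhs => rw [← divX_mul_X_add g, hg0, map_zero, add_zero]
  have hpos : 0 < #s := card_pos.2 ⟨0, h0⟩
  have hz : g.divX = 0 := by
    refine eq_zero_of_natDegree_lt_card_of_eval_eq_zero' _ s (fun v hv => ?_) ?_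
    · by_cases h : v = 0
      · rw [h, ← coeff_zero_eq_eval_zero, coeff_divX, zero_add, hg1]
      · have := hgroot v hv
        rw [← hX, eval_mul, eval_X, mul_eq_zero] at this
        exact this.resolve_right h
    · rw [natDegree_divX_eq_natDegree_tsub_one]
      omega
  rw [hz, zero_mul] at hX
  exact sub_eq_zero.1 (hg ▸ hX.symm)

/-- A polynomial is `q`-linear if only the monomials `X ^ q ^ i` occur in it. -/
def IsQLinear (q : ℕ) (f : C[X]) : Prop :=
  ∀ n, f.coeff n ≠ 0 → ∃ i, n = q ^ i

end Field

variable {F : Type*} [Field F] [Fintype F] {C : Type*} [Field C] [Algebra F C]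

local notation "q" => Fintype.card F

variable (F) in
theorem coe_frobeniusAlgHom_pow (R : Type*) [CommRing R] [Algebra F R] (i : ℕ) (x : R) :
    (FiniteField.frobeniusAlgHom F R ^ i) x = x ^ q ^ i := by
  rw [AlgHom.coe_pow, FiniteField.coe_frobeniusAlgHom, pow_iterate]

theorem IsQLinear.eval_smul_add {f : C[X]} (hf : IsQLinear q f) (a : F) (x y : C) :
    f.eval (a • x + y) = a • f.eval x + f.eval y := by
  simp only [eval_eq_sum, Polynomial.sum, smul_sum, ← sum_add_distrib]
  refine sum_congr rfl fun n hn => ?_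
  obtain ⟨i, rfl⟩ := hf n (mem_support_iff.1 hn)
  simp only [← coe_frobeniusAlgHom_pow F C, map_add, map_smul, mul_add, mul_smul_comm]

variable (F C) in
theorem natCast_card_eq_zero : (q : C) = 0 := by
  rw [← map_natCast (algebraMap F C), FiniteField.cast_card_eq_zero, map_zero]

variable (F) in
theorem coeff_pow_card (f : C[X]) (n : ℕ) :
    (f ^ q).coeff n = if q ∣ n then f.coeff (n / q) ^ q else 0 := by
  have : f ^ q = expand C q (f.map (FiniteField.frobeniusAlgHom F C : C →+* C)) := by
    have hpos : 0 < q := Fintype.card_pos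
    have h : ((FiniteField.frobeniusAlgHom F C[X] : C[X] →+* C[X])) =
        (expand C q : C[X] →+* C[X]).comp
          (mapRingHom (FiniteField.frobeniusAlgHom F C : C →+* C)) := by
      refine Polynomial.ringHom_ext (fun a => ?_) ?_
      · simp
      · simp
    have h2 := congrArg (fun g : C[X] →+* C[X] => g f) h
    simpa using h2
  rw [this, coeff_expand Fintype.card_pos]
  simp

theorem IsQLinear.sub_C_mul_pow {f : C[X]} (hf : IsQLinear q f) (c : C) :
    IsQLinear q (f - Polynomial.C c * f ^ q) := by
  intro n hn
  rw [coeff_sub, coeff_C_mul, coeff_pow_card F] at hn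
  by_cases h : f.coeff n = 0
  · rw [h] at hn
    split_ifs at hn with hd
    · have h' : f.coeff (n / q) ≠ 0 := fun h' => hn (by
        rw [h', zero_pow Fintype.card_ne_zero]; simp)
      obtain ⟨i, hi⟩ := hf _ h'
      exact ⟨i + 1, by rw [pow_succ, ← hi, Nat.div_mul_cancel hd]⟩
    · simp at hn
  · exact hf n h

/-- Every exponent q^i with i > 0 is zero in C. -/
theorem IsQLinear.derivative_eq {f : C[X]} (hf : IsQLinear q f) :
    derivative f = Polynomial.C (f.coeff 1) := by
  ext n
  rw [coeff_derivative, coeff_C]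
  split_ifs with h
  · simp [h]
  · by_cases hn : f.coeff (n + 1) = 0
    · rw [hn, zero_mul]
    · obtain ⟨i, hi⟩ := hf _ hn
      cases i with
      | zero => simp at hi; exact absurd hi h
      | succ i =>
        rw [← Nat.cast_succ, Nat.succ_eq_add_one, hi, pow_succ, Nat.cast_mul,
          natCast_card_eq_zero F C, mul_zero, mul_zero]

theorem card_mul_card_le {V : Submodule F C} (hV : (V : Set C).Finite) {w : C} (hw : w ∉ V)
    (hV' : ((V ⊔ Submodule.span F {w} : Submodule F C) : Set C).Finite) :
    #hV.toFinset * q ≤ #hV'.toFinset := by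
  rw [← Finset.card_univ, ← card_product]
  refine card_le_card_of_injOn (fun x => x.1 + x.2 • w) (fun x hx => ?_) fun x hx y hy hxy => ?_
  · simp only [coe_product, Set.mem_prod, Set.Finite.mem_toFinset, SetLike.mem_coe] at hx ⊢
    exact Submodule.add_mem_sup hx.1 (Submodule.smul_mem _ _ (Submodule.mem_span_singleton_self w))
  · simp only [coe_product, Set.mem_prod, Set.Finite.mem_toFinset, SetLike.mem_coe]
      at hx hy hxy
    have h2 : x.2 = y.2 := by
      by_contra hne
      refine hw ((Submodule.smul_mem_iff V (sub_ne_zero.2 hne)).1 ?_)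
      have : (x.2 - y.2) • w = y.1 - x.1 := by
        rw [sub_smul]; linear_combination hxy
      rw [this]
      exact V.sub_mem hy.1 hx.1
    refine Prod.ext ?_ h2
    rw [h2] at hxy
    exact add_right_cancel hxy

/-- On v + a w, with v in V and a in F, e_V takes the value a e_V(w). Since a^q = a, the right-hand
side vanishes there; its degree is small enough by `card_mul_card_le`, so `eq_expPoly` applies. -/
theorem expPoly_sup_span_singleton {V : Submodule F C} (hV : (V : Set C).Finite) {w : C}
    (hw : w ∉ V) (hlin : IsQLinear q (expPoly hV.toFinset))
    (hV' : ((V ⊔ Submodule.span F {w} : Submodule F C) : Set C).Finite) :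
    expPoly hV'.toFinset = expPoly hV.toFinset -
      Polynomial.C (((expPoly hV.toFinset).eval w ^ (q - 1))⁻¹) * expPoly hV.toFinset ^ q := by
  have h0 : (0 : C) ∈ hV.toFinset := by simp
  have h0' : (0 : C) ∈ hV'.toFinset := by simp
  have hq : 1 < q := Fintype.one_lt_card
  have hc : (expPoly hV.toFinset).eval w ≠ 0 := by
    rw [Ne, expPoly_eval_eq_zero_iff h0]; simpa using hw
  symm
  refine eq_expPoly h0' ?_ (fun x hx => ?_) ?_
  · have hle := card_mul_card_le hV hw hV'
    have hd := expPoly_natDegree_le h0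
    refine (natDegree_sub_le _ _).trans
      (max_le (hd.trans (le_trans (Nat.le_mul_of_pos_right _ (by omega)) hle)) ?_)
    refine (natDegree_C_mul_le _ _).trans (natDegree_pow_le.trans ?_)
    rw [mul_comm]
    exact (Nat.mul_le_mul_right _ hd).trans hle
  · rw [Set.Finite.mem_toFinset] at hx
    obtain ⟨v, hv, y, hy, rfl⟩ := Submodule.mem_sup.1 hx
    obtain ⟨a, rfl⟩ := Submodule.mem_span_singleton.1 hy
    have hv0 : (expPoly hV.toFinset).eval v = 0 := by
      rw [expPoly_eval_eq_zero_iff h0]; simpa using hv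
    rw [eval_sub, eval_mul, eval_C, eval_pow, add_comm, hlin.eval_smul_add, hv0, add_zero,
      _root_.smul_pow, FiniteField.pow_card, mul_smul_comm, ← smul_sub]
    have : (expPoly hV.toFinset).eval w ^ q =
        (expPoly hV.toFinset).eval w ^ (q - 1) * (expPoly hV.toFinset).eval w := by
      rw [← pow_succ]; congr 1; omega
    rw [this, inv_mul_cancel_left₀ (pow_ne_zero _ hc), sub_self, smul_zero]
  · rw [coeff_sub, coeff_C_mul, coeff_pow_card F, expPoly_coeff_one, if_neg, mul_zero, sub_zero]
    rw [Nat.dvd_one]; omega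

/-- Induction on a spanning set: each genuinely new generator composes e_V on the left with some X -
c X^q. -/
theorem isQLinear_expPoly {V : Submodule F C} (hV : (V : Set C).Finite) :
    IsQLinear q (expPoly hV.toFinset) := by
  have key : ∀ (t : Finset C) (U : Submodule F C) (hU : (U : Set C).Finite),
      U = Submodule.span F t → IsQLinear q (expPoly hU.toFinset) := by
    intro t
    induction t using Finset.induction_on with
    | empty =>
      intro U hU h
      have : hU.toFinset = {0} := by ext; simp [h]
      rw [this]
      intro n hn
      refine ⟨0, ?_⟩
      simp [expPoly, coeff_X] at hn
      simp [hn]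
    | insert w t _ ih =>
      intro U hU h
      rw [coe_insert, Submodule.span_insert, sup_comm] at h
      subst h
      have hfin : ((Submodule.span F (t : Set C) : Submodule F C) : Set C).Finite :=
        hU.subset (SetLike.coe_subset_coe.2 le_sup_left)
      by_cases hw : w ∈ Submodule.span F (t : Set C)
      · refine ih _ hU (sup_eq_left.2 ?_)
        simpa using hw
      · rw [expPoly_sup_span_singleton hfin hw (ih _ hfin rfl)]
        exact (ih _ hfin rfl).sub_C_mul_pow _
  exact key hV.toFinset V hV (by simp)

theorem natCast_card_toFinset_eq_zero {V : Submodule F C} (hV : (V : Set C).Finite) {w : C}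
    (hw : w ∈ V) (hw0 : w ≠ 0) : (#hV.toFinset : C) = 0 := by
  have : Finite V := hV
  have hcard : #hV.toFinset = q ^ Module.finrank F V := by
    rw [← Nat.card_eq_fintype_card, ← Module.natCard_eq_pow_finrank, ← Set.ncard_eq_toFinset_card _ hV]
    rfl
  have hpos : Module.finrank F V ≠ 0 := by
    intro h
    rw [Module.finrank_eq_zero_iff_of_free] at h
    have := congrArg Subtype.val (Subsingleton.elim (⟨w, hw⟩ : V) 0)
    exact hw0 this
  rw [hcard, Nat.cast_pow, natCast_card_eq_zero F C, zero_pow hpos]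

/-- The power series identity `e_V(z) ∑_{0 ≠ v} (1 - z / v)⁻¹ = -z`. -/
theorem expPoly_mul_sum_geom {V : Submodule F C} (hV : (V : Set C).Finite) {w : C}
    (hw : w ∈ V) (hw0 : w ≠ 0) :
    (expPoly hV.toFinset : PowerSeries C) *
      PowerSeries.mk (fun k => ∑ v ∈ hV.toFinset.erase 0, (v ^ k)⁻¹) =
        -PowerSeries.X := by
  set s := hV.toFinset.erase 0 with hs
  set P : C[X] := ∏ v ∈ s, (1 - Polynomial.C v⁻¹ * X) with hP
  -- V ≠ 0 has order a positive power of q, which is zero in C.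
  have hcard : ((#s : ℕ) : C[X]) = -1 := by
    have h1 : #s + 1 = #hV.toFinset := card_erase_add_one (by simp)
    have h2 := natCast_card_toFinset_eq_zero hV hw hw0
    rw [← h1, Nat.cast_add, Nat.cast_one] at h2
    rw [← map_natCast Polynomial.C, eq_neg_of_add_eq_zero_left h2, map_neg, map_one]
  have hder : derivative (X * P) = 1 := by
    have := (isQLinear_expPoly hV).derivative_eq
    rw [expPoly_coeff_one, map_one] at this
    exact this
  -- With P_v the product omitting v, the product rule turns (XP)' = 1 into P + ∑ (P - P_v) = 1.
  -- Since `#s` is -1, the P terms cancel and ∑ P_v = -1.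
  have hH : ∑ v ∈ s, ∏ u ∈ s.erase v, (1 - Polynomial.C u⁻¹ * X) = (-1 : C[X]) := by
    rw [derivative_mul, derivative_X, one_mul, hP, derivative_prod_finset, mul_sum] at hder
    have h : ∀ v ∈ s, X * ((∏ u ∈ s.erase v, (1 - Polynomial.C u⁻¹ * X)) *
        derivative (1 - Polynomial.C v⁻¹ * X)) =
        P - ∏ u ∈ s.erase v, (1 - Polynomial.C u⁻¹ * X) := by
      intro v hv
      rw [hP, ← mul_prod_erase s _ hv]
      simp only [derivative_sub, derivative_one, derivative_mul, derivative_C, derivative_X]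
      ring
    rw [sum_congr rfl h, sum_sub_distrib, sum_const, nsmul_eq_mul, hcard] at hder
    linear_combination -hder
  have hgeom : ∀ v : C, ((1 - Polynomial.C v⁻¹ * X : C[X]) : PowerSeries C) *
      PowerSeries.mk (fun k => (v ^ k)⁻¹) = 1 := by
    intro v
    ext n
    have hX : ((1 - Polynomial.C v⁻¹ * X : C[X]) : PowerSeries C) =
      1 - PowerSeries.C v⁻¹ * PowerSeries.X := by simp
    rw [hX, sub_mul, one_mul, mul_assoc, map_sub, PowerSeries.coeff_C_mul]
    cases n with
    | zero => simp
    | succ n =>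
      rw [PowerSeries.coeff_succ_X_mul]
      simp [PowerSeries.coeff_one, pow_succ, mul_comm]
  have hmk : PowerSeries.mk (fun k => ∑ v ∈ s, (v ^ k)⁻¹) =
      ∑ v ∈ s, PowerSeries.mk (fun k => (v ^ k)⁻¹) := by
    ext n
    simp [map_sum]
  rw [hmk, expPoly, ← hs, ← hP, Polynomial.coe_mul, Polynomial.coe_X, mul_assoc, mul_sum]
  have h : ∀ v ∈ s, (P : PowerSeries C) * PowerSeries.mk (fun k => (v ^ k)⁻¹) =
      ((∏ u ∈ s.erase v, (1 - Polynomial.C u⁻¹ * X) : C[X]) : PowerSeries C) := by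
    intro v hv
    rw [hP, ← prod_erase_mul s _ hv, Polynomial.coe_mul, mul_assoc, hgeom, mul_one]
  rw [sum_congr rfl h]
  have := congrArg (Polynomial.coeToPowerSeries.ringHom (R := C)) hH
  rw [map_sum, map_neg, map_one] at this
  simp only [Polynomial.coeToPowerSeries.ringHom_apply] at this
  rw [this, mul_neg, mul_one]

/-- Compare coefficients of z^(q^k) in `expPoly_mul_sum_geom`. Only exponents q^i of e_V contribute,
and by Frobenius the power sum of weight q^k - q^i is the q^i-th power of that of weight q^(k-i) -
1. -/
theorem sum_coeff_mul_powerSum_pow {V : Submodule F C} (hV : (V : Set C).Finite) {w : C}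
    (hw : w ∈ V) (hw0 : w ≠ 0) {k : ℕ} (hk : k ≠ 0) :
    ∑ x ∈ antidiagonal k, (expPoly hV.toFinset).coeff (q ^ x.1) *
      (∑ v ∈ hV.toFinset.erase 0, (v ^ (q ^ x.2 - 1))⁻¹) ^ q ^ x.1 = 0 := by
  have hq : 1 < q := Fintype.one_lt_card
  have h := congrArg (PowerSeries.coeff (q ^ k)) (expPoly_mul_sum_geom hV hw hw0)
  have h1 : q ^ k ≠ 1 := (Nat.one_lt_pow hk hq).ne'
  rw [map_neg, PowerSeries.coeff_X, if_neg h1, neg_zero, PowerSeries.coeff_mul] at h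
  rw [Nat.sum_antidiagonal_eq_sum_range_succ_mk] at h ⊢
  refine Eq.trans ?_ h
  refine sum_of_injOn (fun i => q ^ i) (fun i _ j _ hij => Nat.pow_right_injective hq hij)
    (fun i hi => ?_) (fun n hn hn' => ?_) fun i hi => ?_
  · simp only [coe_range, Set.mem_Iio] at hi ⊢
    exact Nat.lt_succ_of_le (Nat.pow_le_pow_right hq.le (Nat.le_of_lt_succ hi))
  · rw [Polynomial.coeff_coe]
    have : (expPoly hV.toFinset).coeff n = 0 := by
      by_contra hne
      obtain ⟨i, rfl⟩ := isQLinear_expPoly hV n hne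
      refine hn' ⟨i, ?_, rfl⟩
      simp only [coe_range, Set.mem_Iio, mem_range] at hn ⊢
      exact Nat.lt_succ_of_le ((Nat.pow_le_pow_iff_right hq).1 (Nat.le_of_lt_succ hn))
    rw [this, zero_mul]
  · rw [Polynomial.coeff_coe, PowerSeries.coeff_mk, ← coe_frobeniusAlgHom_pow F C, map_sum]
    simp only [coe_frobeniusAlgHom_pow, inv_pow, ← pow_mul]
    have hik : i ≤ k := Nat.le_of_lt_succ (mem_range.1 hi)
    have : (q ^ (k - i) - 1) * q ^ i = q ^ k - q ^ i := by
      rw [Nat.sub_mul, one_mul, ← pow_add, Nat.sub_add_cancel hik]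
    rw [this]

/-- If `V'` arises from `V` by adjoining `d` independent vectors, then `e_{V'}` is the composition
of a `q`-linear polynomial of degree `q ^ d` with `e_V`. -/
theorem exists_coeff_sup_span {C : Type*} [NormedField C] [Algebra F C]
    {V : Submodule F C} (v : ℕ → C) {M : ℝ} (d : ℕ)
    (hV : ((V ⊔ Submodule.span F (v '' Set.Iio d) : Submodule F C) : Set C).Finite)
    (hv : ∀ j < d, v j ∉ V ⊔ Submodule.span F (v '' Set.Iio j))
    (hb : ∀ U : Submodule F C, ∀ hU : (U : Set C).Finite,
      U ≤ V ⊔ Submodule.span F (v '' Set.Iio d) →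
        ∀ j < d, ‖(expPoly hU.toFinset).eval (v j)‖ ≤ M)
    (hV0 : (V : Set C).Finite) :
    ∃ g : ℕ → C, g 0 = 1 ∧ (∀ i, d < i → g i = 0) ∧ 1 ≤ M ^ (q ^ d - 1) * ‖g d‖ ∧
      ∀ k, (expPoly hV.toFinset).coeff (q ^ k) =
        ∑ x ∈ antidiagonal k, g x.1 * (expPoly hV0.toFinset).coeff (q ^ x.2) ^ q ^ x.1 := by
  induction d with
  | zero =>
    refine ⟨fun i => if i = 0 then 1 else 0, by simp, fun i hi => by simp [hi.ne'], by simp,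
      fun k => ?_⟩
    have : hV.toFinset = hV0.toFinset := by ext; simp
    rw [this, Nat.sum_antidiagonal_eq_sum_range_succ_mk, sum_eq_single 0] <;> simp +contextual
  | succ d ih =>
    have hspan : V ⊔ Submodule.span F (v '' Set.Iio (d + 1)) =
        (V ⊔ Submodule.span F (v '' Set.Iio d)) ⊔ Submodule.span F {v d} := by
      rw [sup_assoc, ← Submodule.span_union, ← Set.image_singleton (f := v), ← Set.image_union]
      congr 4
      ext i
      simp [le_iff_lt_or_eq, or_comm]
    have hle : V ⊔ Submodule.span F (v '' Set.Iio d) ≤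
        V ⊔ Submodule.span F (v '' Set.Iio (d + 1)) := hspan ▸ le_sup_left
    have hVd : ((V ⊔ Submodule.span F (v '' Set.Iio d) : Submodule F C) : Set C).Finite :=
      hV.subset (SetLike.coe_subset_coe.2 hle)
    obtain ⟨g, hg0, hgd, hgM, hg⟩ := ih hVd (fun j hj => hv j (hj.trans d.lt_succ_self))
      (fun U hU hUle j hj => hb U hU (hUle.trans hle) j (hj.trans d.lt_succ_self))
    have hq : 1 < q := Fintype.one_lt_card
    have hw := hv d d.lt_succ_self
    set c := (expPoly hVd.toFinset).eval (v d) with hc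
    have hc0 : c ≠ 0 := by
      rw [hc, Ne, expPoly_eval_eq_zero_iff (by simp)]
      simpa using hw
    have hcM : ‖c‖ ≤ M := hb _ hVd hle d d.lt_succ_self
    have hstep : expPoly hV.toFinset = expPoly hVd.toFinset -
        Polynomial.C ((c ^ (q - 1))⁻¹) * expPoly hVd.toFinset ^ q := by
      have hV' := hV
      rw [hspan] at hV'
      rw [← expPoly_sup_span_singleton hVd hw (isQLinear_expPoly hVd) hV']
      congr 1
      ext x
      simp only [Set.Finite.mem_toFinset, hspan]
    -- Left composition of g with X - c^(1-q) X^q. The new top coefficient is -c^(1-q) g_d^q, and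
    -- ‖c‖ ≤ M carries the lower bound along.
    refine ⟨fun i => g i - (c ^ (q - 1))⁻¹ * (if i = 0 then 0 else g (i - 1) ^ q), by simp [hg0],
      fun i hi => ?_, ?_, fun k => ?_⟩
    · have hi0 : i ≠ 0 := by omega
      simp only [hi0, if_false, hgd i (by omega), hgd (i - 1) (by omega),
        zero_pow Fintype.card_ne_zero, mul_zero, sub_zero]
    · simp only [hgd (d + 1) d.lt_succ_self, Nat.add_eq_zero_iff, one_ne_zero, and_false, if_false,
        Nat.add_sub_cancel, zero_sub, norm_neg, norm_mul, norm_inv, norm_pow]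
      have hexp : q ^ (d + 1) - 1 = (q ^ d - 1) * q + (q - 1) := by
        have : 1 ≤ q ^ d := Nat.one_le_pow _ _ hq.le
        rw [Nat.sub_mul, pow_succ, one_mul]
        have : q ≤ q ^ d * q := Nat.le_mul_of_pos_left _ this
        omega
      have hcpos : 0 < ‖c‖ ^ (q - 1) := pow_pos (norm_pos_iff.2 hc0) _
      have h1 : 1 ≤ M ^ (q - 1) * (‖c‖ ^ (q - 1))⁻¹ := by
        rw [← div_eq_mul_inv, one_le_div hcpos]
        exact pow_le_pow_left₀ (norm_nonneg _) hcM _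
      have h2 : 1 ≤ (M ^ (q ^ d - 1) * ‖g d‖) ^ q := one_le_pow₀ hgM
      calc (1 : ℝ) ≤ (M ^ (q ^ d - 1) * ‖g d‖) ^ q * (M ^ (q - 1) * (‖c‖ ^ (q - 1))⁻¹) :=
            one_le_mul_of_one_le_of_one_le h2 h1
        _ = _ := by rw [hexp, pow_add, pow_mul, mul_pow]; ring
    · rw [hstep, coeff_sub, coeff_C_mul, coeff_pow_card F]
      simp only [sub_mul, sum_sub_distrib, mul_assoc, ← mul_sum]
      rw [hg k]
      congr 2
      cases k with
      | zero => simp [hq.ne']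
      | succ k =>
        rw [if_pos (dvd_pow_self _ k.succ_ne_zero), pow_succ, Nat.mul_div_cancel _ (by omega), hg k,
          Nat.sum_antidiagonal_succ, if_pos rfl, zero_mul, zero_add, ← pow_one q,
          ← coe_frobeniusAlgHom_pow F C, map_sum]
        refine sum_congr rfl fun x _ => ?_
        rw [coe_frobeniusAlgHom_pow, pow_one, mul_pow, if_neg (Nat.succ_ne_zero _),
          Nat.add_sub_cancel, ← pow_mul, ← pow_succ]

end FiniteSubspaces

/-! ### Bounds for products over null families -/

section InfiniteProducts

open Finset Polynomial Filter Topology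
open scoped Classical

variable {ι C : Type*} [NormedField C]

/-- All but finitely many factors equal 1; the product of the exceptional ones is the bound. -/
theorem exists_prod_max_le {u : ι → C} (hu : Tendsto u cofinite (𝓝 0)) (R : ℝ) :
    ∃ M : ℝ, 0 ≤ M ∧ ∀ S : Finset ι, ∏ i ∈ S, max 1 (R * ‖u i‖) ≤ M := by
  have hlim : Tendsto (fun i => R * ‖u i‖) cofinite (𝓝 0) := by
    simpa using hu.norm.const_mul R
  have hfin : {i | ¬ R * ‖u i‖ ≤ 1}.Finite :=
    eventually_cofinite.1 (hlim.eventually (ge_mem_nhds one_pos))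
  have hnn : ∀ i, (0 : ℝ) ≤ max 1 (R * ‖u i‖) := fun i => zero_le_one.trans (le_max_left _ _)
  refine ⟨∏ i ∈ hfin.toFinset, max 1 (R * ‖u i‖), prod_nonneg fun i _ => hnn i, fun S => ?_⟩
  have h1 : ∏ i ∈ S, max 1 (R * ‖u i‖) = ∏ i ∈ hfin.toFinset ∩ S, max 1 (R * ‖u i‖) := by
    refine (prod_subset inter_subset_right fun i hi hi' => max_eq_left ?_).symm
    by_contra h
    exact hi' (mem_inter.2 ⟨by simpa using h, hi⟩)
  rw [h1, ← prod_inter_mul_prod_sdiff hfin.toFinset S]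
  exact le_mul_of_one_le_right (prod_nonneg fun i _ => hnn i)
    (Finset.one_le_prod fun i _ => le_max_left _ _)

theorem norm_coeff_one_sub_mul_pow_le (R : ℝ) (c : C) (n : ℕ) :
    ‖(1 - Polynomial.C c * X).coeff n‖ * R ^ n ≤ max 1 (R * ‖c‖) := by
  rcases n with _ | _ | n
  · simp
  · rw [zero_add, pow_one, mul_comm]
    simp [coeff_one]
  · simp [coeff_one]

end InfiniteProducts

/-! ### Entire products over a complete ultrametric field -/

section Ultrametric

open Finset Polynomial Filter Topology
open scoped Classical

variable {ι C : Type*} [NormedField C] [IsUltrametricDist C]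

theorem norm_sub_le_max_norm (x y : C) : ‖x - y‖ ≤ max ‖x‖ ‖y‖ := by
  simpa [sub_eq_add_neg] using IsUltrametricDist.norm_add_le_max x (-y)

theorem norm_prod_one_sub_le (u : ι → C) (z : C) (S : Finset ι) :
    ‖∏ i ∈ S, (1 - u i * z)‖ ≤ ∏ i ∈ S, max 1 (‖z‖ * ‖u i‖) := by
  rw [norm_prod]
  refine Finset.prod_le_prod (fun i _ => norm_nonneg _) fun i _ => (norm_sub_le_max_norm _ _).trans ?_
  rw [norm_one, norm_mul, mul_comm]

/-- Submultiplicativity of the Gauss norm of radius R. -/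
theorem norm_coeff_mul_mul_pow_le {R a b : ℝ} {f g : C[X]} (hR : 0 ≤ R) (ha : 0 ≤ a) (hb : 0 ≤ b)
    (hf : ∀ n, ‖f.coeff n‖ * R ^ n ≤ a) (hg : ∀ n, ‖g.coeff n‖ * R ^ n ≤ b) (n : ℕ) :
    ‖(f * g).coeff n‖ * R ^ n ≤ a * b := by
  rcases hR.eq_or_lt with rfl | hR
  · rcases n with _ | n
    · have h1 := hf 0
      have h2 := hg 0
      rw [pow_zero, mul_one] at *
      rw [mul_coeff_zero, norm_mul]
      exact mul_le_mul h1 h2 (norm_nonneg _) ha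
    · simpa using mul_nonneg ha hb
  rw [← le_div_iff₀ (pow_pos hR n), coeff_mul]
  refine IsUltrametricDist.norm_sum_le_of_forall_le_of_nonneg (by positivity) fun x hx => ?_
  rw [le_div_iff₀ (pow_pos hR n), norm_mul, ← mem_antidiagonal.1 hx, pow_add]
  calc _ = (‖f.coeff x.1‖ * R ^ x.1) * (‖g.coeff x.2‖ * R ^ x.2) := by ring
    _ ≤ a * b := mul_le_mul (hf _) (hg _) (by positivity) ha

theorem norm_coeff_prod_mul_pow_le (u : ι → C) {R : ℝ} (hR : 0 ≤ R) (S : Finset ι) (n : ℕ) :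
    ‖(∏ i ∈ S, (1 - Polynomial.C (u i) * X)).coeff n‖ * R ^ n ≤ ∏ i ∈ S, max 1 (R * ‖u i‖) := by
  have hnn : ∀ i, (0 : ℝ) ≤ max 1 (R * ‖u i‖) := fun i => zero_le_one.trans (le_max_left _ _)
  induction S using Finset.induction_on generalizing n with
  | empty => rcases n with _ | n <;> simp [coeff_one]
  | insert i S hi ih =>
    rw [prod_insert hi, prod_insert hi]
    exact norm_coeff_mul_mul_pow_le hR (hnn i) (prod_nonneg fun i _ => hnn i)
      (norm_coeff_one_sub_mul_pow_le R _) ih n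

theorem norm_coeff_prod_sub_one_mul_pow_le (u : ι → C) {R δ : ℝ} (hR : 0 ≤ R) (hδ : 0 ≤ δ)
    (hδ1 : δ ≤ 1) (S : Finset ι) (hS : ∀ i ∈ S, R * ‖u i‖ ≤ δ) (n : ℕ) :
    ‖(∏ i ∈ S, (1 - Polynomial.C (u i) * X) - 1).coeff n‖ * R ^ n ≤ δ := by
  induction S using Finset.induction_on generalizing n with
  | empty => simpa
  | insert i S hi ih =>
    have hi' : R * ‖u i‖ ≤ δ := hS i (mem_insert_self i S)
    have heq : ∏ j ∈ insert i S, (1 - Polynomial.C (u j) * X) - 1 =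
        (∏ j ∈ S, (1 - Polynomial.C (u j) * X) - 1) * (1 - Polynomial.C (u i) * X) -
          Polynomial.C (u i) * X := by
      rw [prod_insert hi]; ring
    have h1 : ∀ n, ‖(1 - Polynomial.C (u i) * X).coeff n‖ * R ^ n ≤ 1 := fun n =>
      (norm_coeff_one_sub_mul_pow_le R _ n).trans (max_le le_rfl (hi'.trans hδ1))
    have h2 := norm_coeff_mul_mul_pow_le hR hδ zero_le_one
      (ih fun j hj => hS j (mem_insert_of_mem hj)) h1 n
    have h3 : ‖(Polynomial.C (u i) * X).coeff n‖ * R ^ n ≤ δ := by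
      rcases n with _ | _ | n
      · simpa
      · rw [zero_add, pow_one, mul_comm]
        simpa using hi'
      · simpa
    rw [heq, coeff_sub]
    refine (mul_le_mul_of_nonneg_right (norm_sub_le_max_norm _ _) (pow_nonneg hR n)).trans ?_
    rw [max_mul_of_nonneg _ _ (pow_nonneg hR n)]
    exact max_le (h2.trans (mul_one δ).le) h3

/-- With P_S the partial product and S₀ the finite set of i with R‖u i‖ > δ, P_S - P_{S₀} = P_{S₀}
(P_{S \ S₀} - 1) has Gauss norm at most Mδ. The bound is uniform in n, which later controls values
as well as coefficients. -/
theorem exists_norm_coeff_prod_sub_le {u : ι → C} (hu : Tendsto u cofinite (𝓝 0)) {R ε : ℝ}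
    (hR : 0 ≤ R) (hε : 0 < ε) :
    ∃ S₀ : Finset ι, ∀ S, S₀ ⊆ S → ∀ n, ‖(∏ i ∈ S, (1 - Polynomial.C (u i) * X)).coeff n -
      (∏ i ∈ S₀, (1 - Polynomial.C (u i) * X)).coeff n‖ * R ^ n ≤ ε := by
  obtain ⟨M, hM0, hM⟩ := exists_prod_max_le hu R
  -- M + 1 avoids dividing by zero; δ ≤ 1 is needed by `norm_coeff_prod_sub_one_mul_pow_le`.
  set δ := min 1 (ε / (M + 1)) with hδ
  have hM1 : 0 < M + 1 := by linarith
  have hδ0 : 0 < δ := lt_min one_pos (div_pos hε hM1)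
  have hMδ : M * δ ≤ ε := by
    calc M * δ ≤ (M + 1) * (ε / (M + 1)) :=
          mul_le_mul (by linarith) (min_le_right _ _) hδ0.le hM1.le
      _ = ε := mul_div_cancel₀ _ hM1.ne'
  have hlim : Tendsto (fun i => R * ‖u i‖) cofinite (𝓝 0) := by
    simpa using hu.norm.const_mul R
  have hfin : {i | ¬ R * ‖u i‖ ≤ δ}.Finite :=
    eventually_cofinite.1 (hlim.eventually (ge_mem_nhds hδ0))
  refine ⟨hfin.toFinset, fun S hS n => ?_⟩
  have heq : ∏ i ∈ S, (1 - Polynomial.C (u i) * X) -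
      ∏ i ∈ hfin.toFinset, (1 - Polynomial.C (u i) * X) =
      (∏ i ∈ hfin.toFinset, (1 - Polynomial.C (u i) * X)) *
        (∏ i ∈ S \ hfin.toFinset, (1 - Polynomial.C (u i) * X) - 1) := by
    rw [← prod_sdiff hS]; ring
  rw [← coeff_sub, heq]
  refine le_trans ?_ hMδ
  refine norm_coeff_mul_mul_pow_le hR hM0 hδ0.le
    (fun n => (norm_coeff_prod_mul_pow_le u hR _ n).trans (hM _)) (fun n => ?_) n
  refine norm_coeff_prod_sub_one_mul_pow_le u hR hδ0.le (min_le_left _ _) _ (fun i hi => ?_) n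
  by_contra h
  exact (mem_sdiff.1 hi).2 (by simpa using h)

theorem exists_norm_eval_prod_le {u : ι → C} (hu : Tendsto u cofinite (𝓝 0)) (z : C) :
    ∃ M : ℝ, 0 ≤ M ∧ ∀ S : Finset ι, ‖∏ i ∈ S, (1 - u i * z)‖ ≤ M := by
  obtain ⟨M, hM0, hM⟩ := exists_prod_max_le hu ‖z‖
  exact ⟨M, hM0, fun S => (norm_prod_one_sub_le u z S).trans (hM S)⟩

/-- In a complete ultrametric field, the product `∏ (1 - u i z)` over a null family `u` defines an
entire function, whose coefficients are the limits of those of the finite products. -/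
theorem exists_coeff_tprod_one_sub [CompleteSpace C] {u : ι → C}
    (hu : Tendsto u cofinite (𝓝 0)) :
    ∃ c : ℕ → C, (∀ n, Tendsto
        (fun S : Finset ι => (∏ i ∈ S, (1 - Polynomial.C (u i) * X)).coeff n) atTop (𝓝 (c n))) ∧
      ∀ z, HasSum (fun n => c n * z ^ n) (∏' i, (1 - u i * z)) := by
  set P : Finset ι → C[X] := fun S => ∏ i ∈ S, (1 - Polynomial.C (u i) * X) with hP
  have hcauchy : ∀ n, CauchySeq fun S => (P S).coeff n := fun n => by
    refine Metric.cauchySeq_iff'.2 fun ε hε => ?_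
    obtain ⟨S₀, hS₀⟩ := exists_norm_coeff_prod_sub_le hu zero_le_one (half_pos hε)
    refine ⟨S₀, fun S hS => ?_⟩
    have := hS₀ S hS n
    rw [one_pow, mul_one] at this
    rw [dist_eq_norm]
    exact this.trans_lt (half_lt_self hε)
  choose c hc using fun n => cauchySeq_tendsto_of_complete (hcauchy n)
  refine ⟨c, hc, fun z => ?_⟩
  -- A radius strictly larger than ‖z‖ gives a geometric majorant.
  set R := ‖z‖ + 1 with hRdef
  have hR : 0 < R := by positivity
  have hzR : ‖z‖ ≤ R := by linarith
  have hsum : Summable fun n => c n * z ^ n := by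
    obtain ⟨M, hM0, hM⟩ := exists_prod_max_le hu R
    have hcM : ∀ n, ‖c n‖ * R ^ n ≤ M := fun n =>
      le_of_tendsto ((hc n).norm.mul_const _)
        (Eventually.of_forall fun S => (norm_coeff_prod_mul_pow_le u hR.le S n).trans (hM S))
    have hgeo : Summable fun n => M * (‖z‖ / R) ^ n :=
      (summable_geometric_of_lt_one (by positivity)
        ((div_lt_one hR).2 (by linarith))).mul_left M
    refine Summable.of_norm_bounded hgeo fun n => ?_
    rw [norm_mul, norm_pow, div_pow, mul_div_assoc', le_div_iff₀ (pow_pos hR n)]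
    calc _ = (‖c n‖ * R ^ n) * ‖z‖ ^ n := by ring
      _ ≤ _ := mul_le_mul_of_nonneg_right (hcM n) (by positivity)
  have hprod : HasProd (fun i => 1 - u i * z) (∑' n, c n * z ^ n) := by
    refine Metric.tendsto_atTop.2 fun ε hε => ?_
    obtain ⟨S₀, hS₀⟩ := exists_norm_coeff_prod_sub_le hu hR.le (half_pos hε)
    refine ⟨S₀, fun S hS => ?_⟩
    have hcS : ∀ n, ‖(P S).coeff n - c n‖ * R ^ n ≤ ε / 2 := fun n => by
      refine le_of_tendsto ((tendsto_const_nhds.sub (hc n)).norm.mul_const _) ?_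
      filter_upwards [eventually_ge_atTop S₀] with S' hS'
      have heq : (P S).coeff n - (P S').coeff n =
        ((P S).coeff n - (P S₀).coeff n) - ((P S').coeff n - (P S₀).coeff n) := by ring
      rw [heq]
      refine (mul_le_mul_of_nonneg_right (norm_sub_le_max_norm _ _) (pow_nonneg hR.le n)).trans ?_
      rw [max_mul_of_nonneg _ _ (pow_nonneg hR.le n)]
      exact max_le (hS₀ S hS n) (hS₀ S' hS' n)
    have heval : HasSum (fun n => (P S).coeff n * z ^ n) (∏ i ∈ S, (1 - u i * z)) := by
      have : ∏ i ∈ S, (1 - u i * z) = ∑ n ∈ (P S).support, (P S).coeff n * z ^ n := by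
        have h := eval_eq_sum (p := P S) (x := z)
        rw [Polynomial.sum_def] at h
        rw [← h, hP, eval_prod]
        simp
      rw [this]
      refine hasSum_sum_of_ne_finset_zero fun n hn => ?_
      rw [notMem_support_iff.1 hn, zero_mul]
    rw [dist_eq_norm, ← heval.tsum_eq, ← heval.summable.tsum_sub hsum]
    refine (IsUltrametricDist.norm_tsum_le_of_forall_le_of_nonneg (half_pos hε).le
      fun n => ?_).trans_lt (half_lt_self hε)
    rw [← sub_mul, norm_mul, norm_pow]
    exact (mul_le_mul_of_nonneg_left (pow_le_pow_left₀ (norm_nonneg z) hzR n)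
      (norm_nonneg _)).trans (hcS n)
  rw [hprod.tprod_eq]
  exact hsum.hasSum

end Ultrametric

/-! ### Twisted power series and the descent -/

section TwistedConvolution

open Finset

/-- If the window m + 1, …, m + r is zero, then so is f m, and the window one step lower is zero
too. At the bottom this contradicts f 0 ≠ 0. -/
theorem exists_ne_zero_of_descent {C : Type*} [Field C] {f : ℕ → C} {r : ℕ} (hr : 1 ≤ r) (h0 : f 0 ≠ 0)
    (hf : ∀ m, (∀ i, m < i → i ≤ m + r → f i = 0) → f m = 0) (m : ℕ) :
    ∃ i ∈ Icc m (m + r - 1), f i ≠ 0 := by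
  induction m with
  | zero => exact ⟨0, by simp, h0⟩
  | succ m ih =>
    by_contra! h
    have h' : ∀ i, m < i → i ≤ m + r → f i = 0 := fun i h1 h2 =>
      h i (mem_Icc.2 ⟨h1, by omega⟩)
    obtain ⟨i, hi, hne⟩ := ih
    rw [mem_Icc] at hi
    rcases hi.1.eq_or_lt with rfl | hlt
    · exact hne (hf _ h')
    · exact hne (h' i hlt (by omega))

variable {F : Type*} [Fintype F] {C : Type*} [Field C]

local notation "q" => Fintype.card F

variable (F) in
/-- The product of the twisted power series `∑ a i τ ^ i` and `∑ b i τ ^ i`, where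
`τ c = c ^ q τ` for scalars `c`. -/
def twistedMul (a b : ℕ → C) (k : ℕ) : C :=
  ∑ x ∈ antidiagonal k, a x.1 * b x.2 ^ q ^ x.1

theorem twistedMul_left_cancel {a x y : ℕ → C} (ha : a 0 ≠ 0)
    (h : twistedMul F a x = twistedMul F a y) : x = y := by
  funext k
  induction k using Nat.strong_induction_on with
  | _ k ih =>
    have hk := congrFun h k
    simp only [twistedMul, Nat.sum_antidiagonal_eq_sum_range_succ_mk, sum_range_succ', Nat.sub_zero,
      pow_zero, pow_one] at hk
    have hs : ∑ i ∈ range k, a (i + 1) * x (k - (i + 1)) ^ q ^ (i + 1) =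
        ∑ i ∈ range k, a (i + 1) * y (k - (i + 1)) ^ q ^ (i + 1) :=
      sum_congr rfl fun i hi => by
        rw [ih (k - (i + 1)) (by have := mem_range.1 hi; omega)]
    rw [hs] at hk
    exact mul_left_cancel₀ ha (add_left_cancel hk)

theorem twistedMul_eq_mul_of_left {a b : ℕ → C} (ha : ∀ i, i ≠ 0 → a i = 0) (k : ℕ) :
    twistedMul F a b k = a 0 * b k := by
  rw [twistedMul, Nat.sum_antidiagonal_eq_sum_range_succ_mk, sum_eq_single 0]
  · simp
  · intro i _ hi
    rw [ha i hi, zero_mul]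
  · simp

variable [Nonempty F]

theorem twistedMul_eq_mul_of_right {a b : ℕ → C} (hb : ∀ i, i ≠ 0 → b i = 0) (k : ℕ) :
    twistedMul F a b k = a k * b 0 ^ q ^ k := by
  rw [twistedMul, Nat.sum_antidiagonal_eq_sum_range_succ_mk, sum_eq_single k]
  · simp
  · intro i hi hik
    rw [hb (k - i) (by have := mem_range.1 hi; omega),
      zero_pow (pow_ne_zero _ Fintype.card_ne_zero), mul_zero]
  · simp

/-- In degree m + r the only term surviving a zero window is φ_r α_m^(q^r). -/
theorem exists_ne_zero_of_twistedMul_left {α φ : ℕ → C} {r : ℕ} (hr : 1 ≤ r) (hα : α 0 ≠ 0)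
    (hφ : ∀ i, r < i → φ i = 0) (hφr : φ r ≠ 0) {c : ℕ → C}
    (h : ∀ k, c k * α k = twistedMul F φ α k) (m : ℕ) :
    ∃ i ∈ Icc m (m + r - 1), α i ≠ 0 := by
  refine exists_ne_zero_of_descent hr hα (fun m hm => ?_) m
  have hk := h (m + r)
  rw [hm (m + r) (by omega) le_rfl, mul_zero, twistedMul, sum_eq_single (r, m)] at hk
  · exact eq_zero_of_pow_eq_zero (mul_eq_zero.1 hk.symm |>.resolve_left hφr)
  · rintro ⟨i, j⟩ hx hne
    rw [HasAntidiagonal.mem_antidiagonal] at hx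
    dsimp only at hx ⊢
    rcases lt_trichotomy i r with hi | rfl | hi
    · rw [hm j (by omega) (by omega), zero_pow (pow_ne_zero _ Fintype.card_ne_zero), mul_zero]
    · exact (hne (by rw [show j = m by omega])).elim
    · rw [hφ i hi, zero_mul]
  · intro hn
    exact absurd (HasAntidiagonal.mem_antidiagonal.2 (add_comm _ _)) hn

/-- Mirror image: the surviving term is ε_m φ_r^(q^m). -/
theorem exists_ne_zero_of_twistedMul_right {ε φ : ℕ → C} {r : ℕ} (hr : 1 ≤ r) (hε : ε 0 ≠ 0)
    (hφ : ∀ i, r < i → φ i = 0) (hφr : φ r ≠ 0) {t : C}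
    (h : ∀ k, t * ε k = twistedMul F ε φ k) (m : ℕ) :
    ∃ i ∈ Icc m (m + r - 1), ε i ≠ 0 := by
  refine exists_ne_zero_of_descent hr hε (fun m hm => ?_) m
  have hk := h (m + r)
  rw [hm (m + r) (by omega) le_rfl, mul_zero, twistedMul, sum_eq_single (m, r)] at hk
  · exact (mul_eq_zero.1 hk.symm).resolve_right (pow_ne_zero _ hφr)
  · rintro ⟨i, j⟩ hx hne
    rw [HasAntidiagonal.mem_antidiagonal] at hx
    dsimp only at hx ⊢
    rcases lt_trichotomy j r with hj | rfl | hj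
    · rw [hm i (by omega) (by omega), zero_mul]
    · exact (hne (by rw [show i = m by omega])).elim
    · rw [hφ j hj, zero_pow (pow_ne_zero _ Fintype.card_ne_zero), mul_zero]
  · intro hn
    exact (hn (HasAntidiagonal.mem_antidiagonal.2 rfl)).elim

end TwistedConvolution

/-! ### From the exponential to the logarithm -/

section TwistedInverse

open Finset

variable {F : Type*} [Field F] [Fintype F] {C : Type*} [Field C] [Algebra F C]

local notation "q" => Fintype.card F

variable (F) in
theorem twistedMul_assoc (a b c : ℕ → C) :
    twistedMul F (twistedMul F a b) c = twistedMul F a (twistedMul F b c) := by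
  funext n
  have hpow : ∀ i j, (∑ y ∈ antidiagonal j, b y.1 * c y.2 ^ q ^ y.1) ^ q ^ i =
      ∑ y ∈ antidiagonal j, b y.1 ^ q ^ i * c y.2 ^ q ^ (y.1 + i) := fun i j => by
    rw [← coe_frobeniusAlgHom_pow F C, map_sum]
    refine sum_congr rfl fun y _ => ?_
    rw [coe_frobeniusAlgHom_pow, mul_pow, ← pow_mul, ← pow_add]
  simp only [twistedMul, hpow, sum_mul, mul_sum, sum_sigma']
  apply sum_nbij' (fun ⟨⟨_i, j⟩, ⟨k, l⟩⟩ ↦ ⟨(k, l + j), (l, j)⟩)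
    (fun ⟨⟨i, _j⟩, ⟨k, l⟩⟩ ↦ ⟨(i + k, l), (i, k)⟩)
  · simp only [mem_sigma, HasAntidiagonal.mem_antidiagonal, and_true]
    rintro ⟨⟨i, j⟩, ⟨k, l⟩⟩ ⟨h1, h2⟩
    dsimp at *
    omega
  · simp only [mem_sigma, HasAntidiagonal.mem_antidiagonal, and_true]
    rintro ⟨⟨i, j⟩, ⟨k, l⟩⟩ ⟨h1, h2⟩
    dsimp at *
    omega
  · simp only [mem_sigma, HasAntidiagonal.mem_antidiagonal]
    rintro ⟨⟨i, j⟩, ⟨k, l⟩⟩ ⟨h1, h2⟩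
    dsimp at *
    subst h2
    rfl
  · simp only [mem_sigma, HasAntidiagonal.mem_antidiagonal]
    rintro ⟨⟨i, j⟩, ⟨k, l⟩⟩ ⟨h1, h2⟩
    dsimp at *
    subst h2
    rfl
  · simp only [mem_sigma, HasAntidiagonal.mem_antidiagonal]
    rintro ⟨⟨i, j⟩, ⟨k, l⟩⟩ ⟨h1, h2⟩
    dsimp at *
    subst h2
    rw [mul_assoc, add_comm l k]

/-- If `α t = φ α` and `α ε = -1` as twisted power series, then `ε φ = t ε`. -/
theorem twistedMul_eq_mul_of_inverse {α ε φ : ℕ → C} {t : C} (hα : α 0 = 1)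
    (h : ∀ k, t ^ q ^ k * α k = twistedMul F φ α k)
    (h0 : twistedMul F α ε 0 = -1) (hinv : ∀ k, k ≠ 0 → twistedMul F α ε k = 0) (k : ℕ) :
    t * ε k = twistedMul F ε φ k := by
  -- The scalar t as a constant twisted series, so that the hypothesis `h` reads αδ = φα.
  set δ : ℕ → C := fun i => if i = 0 then t else 0 with hδ
  have hδ0 : ∀ i, i ≠ 0 → δ i = 0 := fun i hi => if_neg hi
  have hφα : twistedMul F φ α = twistedMul F α δ := by
    funext k
    rw [← h, twistedMul_eq_mul_of_right hδ0, mul_comm]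
    simp [hδ]
  -- Cancel α on the left: αδε = φαε = -φ = αεφ.
  have key : twistedMul F δ ε = twistedMul F ε φ := by
    refine twistedMul_left_cancel (F := F) (a := α) (by rw [hα]; exact one_ne_zero) ?_
    rw [← twistedMul_assoc, ← twistedMul_assoc, ← hφα, twistedMul_assoc]
    funext k
    rw [twistedMul_eq_mul_of_left hinv, twistedMul_eq_mul_of_right hinv, h0,
      ← coe_frobeniusAlgHom_pow F C, map_neg, map_one, mul_comm]
  rw [← key, twistedMul_eq_mul_of_left hδ0]
  simp [hδ]

end TwistedInverse

/-! ### Lattices and their filtration by degree -/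

section Lattices

open Finset Polynomial Filter Topology
open scoped Classical

section Algebra

variable {F C : Type*} [Field F] [Field C] [Algebra F C] {r : ℕ}

/-- The map `a ↦ ∑ a_j(t) ω_j` on vectors of polynomials. -/
def latticeMap (t : C) (ω : Fin r → C) : (Fin r → F[X]) →ₗ[F] C where
  toFun a := ∑ j, aeval t (a j) * ω j
  map_add' a b := by simp [add_mul, sum_add_distrib]
  map_smul' c a := by simp [smul_sum]

theorem latticeMap_apply (t : C) (ω : Fin r → C) (a : Fin r → F[X]) :
    latticeMap t ω a = ∑ j, aeval t (a j) * ω j := rfl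

theorem latticeMap_smul (t c : C) (ω : Fin r → C) (a : Fin r → F[X]) :
    latticeMap t (c • ω) a = c * latticeMap t ω a := by
  simp only [latticeMap_apply, mul_sum, Pi.smul_apply, smul_eq_mul]
  exact sum_congr rfl fun j _ => by ring

theorem latticeMap_single (t : C) (ω : Fin r → C) (j : Fin r) (p : F[X]) :
    latticeMap t ω (Pi.single j p) = aeval t p * ω j := by
  rw [latticeMap_apply, sum_eq_single j]
  · simp
  · intro i _ hi
    simp [Pi.single_eq_of_ne hi]
  · simp

variable (F) in
/-- The elements `∑ a_j(t) ω_j` with `deg a_j < n` for all `j`. -/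
def latticeLT (t : C) (ω : Fin r → C) (n : ℕ) : Submodule F C :=
  (Submodule.pi Set.univ fun _ => degreeLT F n).map (latticeMap t ω)

theorem mem_latticeLT {t : C} {ω : Fin r → C} {n : ℕ} {x : C} :
    x ∈ latticeLT F t ω n ↔
      ∃ a : Fin r → F[X], (∀ j, (a j).degree < n) ∧ latticeMap t ω a = x := by
  simp [latticeLT, mem_degreeLT]

theorem latticeLT_mono (t : C) (ω : Fin r → C) : Monotone (latticeLT F t ω) := by
  intro m n hmn x hx
  obtain ⟨a, ha, rfl⟩ := mem_latticeLT.1 hx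
  exact mem_latticeLT.2 ⟨a, fun j => (ha j).trans_le (by exact_mod_cast hmn), rfl⟩

theorem mem_range_of_mem_latticeLT {t : C} {ω : Fin r → C} {n : ℕ} {x : C}
    (hx : x ∈ latticeLT F t ω n) : x ∈ Set.range (latticeMap (F := F) t ω) := by
  obtain ⟨a, -, rfl⟩ := mem_latticeLT.1 hx
  exact ⟨a, rfl⟩

theorem exists_mem_latticeLT (t : C) (ω : Fin r → C) (a : Fin r → F[X]) :
    ∃ n, latticeMap t ω a ∈ latticeLT F t ω n := by
  refine ⟨univ.sup (fun j => (a j).natDegree) + 1, mem_latticeLT.2 ⟨a, fun j => ?_, rfl⟩⟩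
  refine degree_le_natDegree.trans_lt ?_
  exact_mod_cast Nat.lt_succ_of_le (le_sup (f := fun j => (a j).natDegree) (mem_univ j))

theorem finite_latticeLT [Fintype F] (t : C) (ω : Fin r → C) (n : ℕ) :
    ((latticeLT F t ω n : Submodule F C) : Set C).Finite := by
  have : Finite (degreeLT F n) := (degreeLTEquiv F n).toEquiv.finite_iff.2 inferInstance
  have h : (Set.univ.pi fun _ : Fin r => ((degreeLT F n : Submodule F F[X]) : Set F[X])).Finite :=
    Set.Finite.pi' (fun _ => Set.toFinite _) |>.subset fun a ha j => ha j trivial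
  exact h.image _

theorem mem_latticeLT_smul {t c : C} (hc : c ≠ 0) {ω : Fin r → C} {n : ℕ} {x : C} :
    x ∈ latticeLT F t (c⁻¹ • ω) n ↔ c * x ∈ latticeLT F t ω n := by
  simp only [mem_latticeLT, latticeMap_smul, inv_mul_eq_iff_eq_mul₀ hc]

/-- Split each polynomial as X times its `divX` plus its constant term; the factor t from X cancels
t⁻¹. The scaling by t⁻¹ makes V_n a subspace of the larger space. -/
theorem latticeLT_succ {t : C} (ht : t ≠ 0) (ω : Fin r → C) (n : ℕ) :
    latticeLT F t (t⁻¹ • ω) (n + 1) =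
      latticeLT F t ω n ⊔ Submodule.span F (Set.range (t⁻¹ • ω)) := by
  have hX : ∀ a : Fin r → F[X], latticeMap t ω a =
      latticeMap t (t⁻¹ • ω) fun j => X * a j := fun a => by
    rw [latticeMap_smul, latticeMap_apply, latticeMap_apply, mul_sum]
    refine sum_congr rfl fun j _ => ?_
    rw [map_mul, aeval_X, mul_assoc, inv_mul_cancel_left₀ ht]
  apply le_antisymm
  · intro x hx
    obtain ⟨a, ha, rfl⟩ := mem_latticeLT.1 hx
    have hsplit : a = (fun j => X * (a j).divX) + fun j => Polynomial.C ((a j).coeff 0) := by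
      funext j
      simp [X_mul_divX_add]
    rw [hsplit, map_add, ← hX]
    refine Submodule.add_mem_sup (mem_latticeLT.2 ⟨_, fun j => ?_, rfl⟩) ?_
    · have h := ha j
      rw [degree_lt_iff_coeff_zero] at h ⊢
      intro m hm
      rw [coeff_divX]
      exact h _ (by omega)
    · rw [latticeMap_apply]
      refine Submodule.sum_mem _ fun j _ => ?_
      rw [aeval_C, ← Algebra.smul_def]
      exact Submodule.smul_mem _ _ (Submodule.subset_span ⟨j, rfl⟩)
  · refine sup_le (fun x hx => ?_) (Submodule.span_le.2 ?_)
    · obtain ⟨a, ha, rfl⟩ := mem_latticeLT.1 hx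
      refine mem_latticeLT.2 ⟨_, fun j => ?_, (hX a).symm⟩
      have h := ha j
      rw [degree_lt_iff_coeff_zero] at h ⊢
      intro m hm
      obtain ⟨m, rfl⟩ : ∃ k, m = k + 1 := ⟨m - 1, by omega⟩
      rw [coeff_X_mul]
      exact h _ (by omega)
    · rintro _ ⟨j, rfl⟩
      refine mem_latticeLT.2 ⟨Pi.single j 1, fun i => ?_, by rw [latticeMap_single]; simp⟩
      by_cases hij : i = j
      · subst hij
        rw [Pi.single_eq_same, degree_one]
        exact_mod_cast n.succ_pos
      · rw [Pi.single_eq_of_ne hij, degree_zero]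
        exact WithBot.bot_lt_coe _

/-- Every element of the right-hand space comes from a vector whose j-th entry has zero constant
term, whereas t⁻¹ω_j comes from the j-th unit vector; injectivity separates them. -/
theorem notMem_latticeLT_sup_span {t : C} (ht : t ≠ 0) {ω : Fin r → C}
    (hinj : Function.Injective (latticeMap (F := F) t (t⁻¹ • ω))) (n : ℕ) (j : Fin r) :
    (t⁻¹ • ω) j ∉ latticeLT F t ω n ⊔ Submodule.span F ((t⁻¹ • ω) '' Set.Iio j) := by
  set K : Submodule F (Fin r → F[X]) := LinearMap.ker (lcoeff F 0 ∘ₗ LinearMap.proj j) with hK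
  have hle : latticeLT F t ω n ⊔ Submodule.span F ((t⁻¹ • ω) '' Set.Iio j) ≤
      K.map (latticeMap t (t⁻¹ • ω)) := by
    refine sup_le (fun x hx => ?_) (Submodule.span_le.2 ?_)
    · obtain ⟨a, ha, rfl⟩ := mem_latticeLT.1 hx
      refine ⟨fun j => X * a j, by simp [hK], ?_⟩
      rw [latticeMap_smul, latticeMap_apply, latticeMap_apply, mul_sum]
      refine sum_congr rfl fun j _ => ?_
      rw [map_mul, aeval_X, mul_assoc, inv_mul_cancel_left₀ ht]
    · rintro _ ⟨i, hi, rfl⟩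
      refine ⟨Pi.single i 1, ?_, by rw [latticeMap_single]; simp⟩
      have : j ≠ i := (Set.mem_Iio.1 hi).ne'
      simp [hK, Pi.single_eq_of_ne this]
  intro hmem
  obtain ⟨a, ha, hax⟩ := hle hmem
  have : a = Pi.single j 1 := hinj (by rw [hax, latticeMap_single]; simp)
  simp [hK, this] at ha

end Algebra

/-- By uniqueness, the exponential of c⁻¹s is c⁻¹ e_s(cz). -/
theorem expPoly_coeff_smul {C : Type*} [Field C] {c : C} (hc : c ≠ 0) {s s' : Finset C}
    (h0 : 0 ∈ s) (h : ∀ x, x ∈ s' ↔ c * x ∈ s) (n : ℕ) :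
    (expPoly s').coeff n = c⁻¹ * c ^ n * (expPoly s).coeff n := by
  have hcard : #s' = #s := by
    refine card_nbij' (fun x => c * x) (fun x => c⁻¹ * x) (fun x hx => (h x).1 hx)
      (fun x hx => (h _).2 ?_) (fun x _ => inv_mul_cancel_left₀ hc x)
      fun x _ => mul_inv_cancel_left₀ hc x
    simpa [mul_inv_cancel_left₀ hc] using hx
  have h0' : 0 ∈ s' := (h 0).2 (by simpa)
  rw [← eq_expPoly h0' (f := Polynomial.C c⁻¹ * (expPoly s).comp (Polynomial.C c * X))]
  · rw [coeff_C_mul, comp_C_mul_X_coeff]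
    ring
  · refine (natDegree_C_mul_le _ _).trans (natDegree_comp_le.trans ?_)
    rw [natDegree_C_mul_X _ hc, mul_one, hcard]
    exact expPoly_natDegree_le h0
  · intro v hv
    have := (expPoly_eval_eq_zero_iff h0).2 ((h v).1 hv)
    simp [this]
  · rw [coeff_C_mul, comp_C_mul_X_coeff, expPoly_coeff_one]
    simp [hc]

/-! ### Passage from finite subspaces to the lattice -/

section Limits

variable {F C : Type*} [Field F] [Fintype F] [NormedField C] [Algebra F C] {r : ℕ}

local notation "q" => Fintype.card F

theorem tendsto_inv_cofinite {L : Set C} (hL : ∀ R : ℝ, {x ∈ L | ‖x‖ ≤ R}.Finite) :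
    Tendsto (fun l : {l : C // l ∈ L ∧ l ≠ 0} => l.1⁻¹) cofinite (𝓝 0) := by
  refine Metric.tendsto_nhds.2 fun ε hε => ?_
  rw [eventually_cofinite]
  refine Set.Finite.of_finite_image ((hL ε⁻¹).subset ?_) Subtype.val_injective.injOn
  rintro _ ⟨l, hl, rfl⟩
  refine ⟨l.2.1, ?_⟩
  have hl' : ε ≤ ‖l.1‖⁻¹ := by simpa using hl
  exact (le_inv_comm₀ hε (norm_pos_iff.2 l.2.2)).1 hl'

theorem exists_expPoly_eval_le [IsUltrametricDist C] {L : Set C}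
    (hL : ∀ R : ℝ, {x ∈ L | ‖x‖ ≤ R}.Finite) (z : C) :
    ∃ M : ℝ, 0 ≤ M ∧ ∀ s : Finset C, (s : Set C) ⊆ L → ‖(expPoly s).eval z‖ ≤ M := by
  obtain ⟨M, hM0, hM⟩ := exists_norm_eval_prod_le (tendsto_inv_cofinite hL) z
  refine ⟨‖z‖ * M, by positivity, fun s hs => ?_⟩
  rw [expPoly_eval, norm_mul]
  refine mul_le_mul_of_nonneg_left ?_ (norm_nonneg z)
  have := hM ((s.erase 0).subtype fun l => l ∈ L ∧ l ≠ 0)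
  rw [prod_subtype_of_mem (fun l => 1 - l⁻¹ * z)
    fun l hl => ⟨hs (mem_of_mem_erase hl), ne_of_mem_erase hl⟩] at this
  simpa [div_eq_inv_mul] using this

/-- The finite subset of nonzero elements of `latticeLT F t ω n`, inside the lattice. -/
def latticeFinset (t : C) (ω : Fin r → C) (n : ℕ) :
    Finset {l : C // l ∈ Set.range (latticeMap (F := F) t ω) ∧ l ≠ 0} :=
  ((finite_latticeLT (F := F) t ω n).toFinset.erase 0).subtype _

theorem mem_range_and_ne_zero {t : C} {ω : Fin r → C} {n : ℕ} {x : C}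
    (hx : x ∈ (finite_latticeLT (F := F) t ω n).toFinset.erase 0) :
    x ∈ Set.range (latticeMap (F := F) t ω) ∧ x ≠ 0 :=
  ⟨mem_range_of_mem_latticeLT (F := F) (n := n) (by simpa using mem_of_mem_erase hx),
    ne_of_mem_erase hx⟩

theorem tendsto_latticeFinset (t : C) (ω : Fin r → C) :
    Tendsto (latticeFinset (F := F) t ω) atTop atTop := by
  refine tendsto_atTop_finset_of_monotone (fun m n hmn l hl => ?_) fun l => ?_
  · simp only [latticeFinset, mem_subtype, mem_erase, Set.Finite.mem_toFinset,
      SetLike.mem_coe] at hl ⊢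
    exact ⟨hl.1, latticeLT_mono t ω hmn hl.2⟩
  · obtain ⟨a, ha⟩ := l.2.1
    obtain ⟨n, hn⟩ := exists_mem_latticeLT t ω a
    refine ⟨n, ?_⟩
    simp only [latticeFinset, mem_subtype, mem_erase, Set.Finite.mem_toFinset, SetLike.mem_coe]
    exact ⟨l.2.2, ha ▸ hn⟩

variable [IsUltrametricDist C] [CompleteSpace C]

/-- The coefficients of the exponential functions of the finite subspaces of a lattice converge
to those of the exponential function of the lattice. -/
theorem exists_exp_coeff (t : C) (ω : Fin r → C)
    (hL : ∀ R : ℝ, {x ∈ Set.range (latticeMap (F := F) t ω) | ‖x‖ ≤ R}.Finite) :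
    ∃ α : ℕ → C, (∀ k, Tendsto (fun n =>
        (expPoly (finite_latticeLT (F := F) t ω n).toFinset).coeff (q ^ k)) atTop (𝓝 (α k))) ∧
      ∀ z, HasSum (fun i => α i * z ^ q ^ i)
        (z * ∏' l : {l : C // l ∈ Set.range (latticeMap (F := F) t ω) ∧ l ≠ 0}, (1 - z / l.1)) := by
  obtain ⟨c, hc, hsum⟩ := exists_coeff_tprod_one_sub (tendsto_inv_cofinite hL)
  have hq : 1 < q := Fintype.one_lt_card
  have hlim : ∀ m, Tendsto (fun n =>
      (expPoly (finite_latticeLT (F := F) t ω n).toFinset).coeff (m + 1)) atTop (𝓝 (c m)) := by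
    intro m
    refine ((hc m).comp (tendsto_latticeFinset (F := F) t ω)).congr fun n => ?_
    rw [Function.comp, expPoly_coeff_succ, latticeFinset,
      prod_subtype_of_mem (fun l : C => 1 - Polynomial.C l⁻¹ * X)
        fun l hl => mem_range_and_ne_zero hl]
  have hpow : ∀ k, q ^ k - 1 + 1 = q ^ k := fun k =>
    Nat.sub_add_cancel (Nat.one_le_pow _ _ (by omega))
  -- The infinite product lacks the leading factor z, whence the shift by one.
  refine ⟨fun k => c (q ^ k - 1), fun k => ?_, fun z => ?_⟩
  · have := hlim (q ^ k - 1)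
    rwa [hpow] at this
  · have h1 : HasSum (fun n => z * (c n * z ^ n))
        (z * ∏' l : {l : C // l ∈ Set.range (latticeMap (F := F) t ω) ∧ l ≠ 0}, (1 - z / l.1)) := by
      simp only [div_eq_inv_mul]
      exact (hsum z).mul_left z
    have hinj : Function.Injective fun k => q ^ k - 1 := fun i j hij => by
      refine Nat.pow_right_injective hq ?_
      dsimp only at hij ⊢
      rw [← hpow i, ← hpow j, hij]
    refine ((hinj.hasSum_iff ?_).2 h1).congr_fun fun k => ?_
    · intro m hm
      have h0 : c m = 0 := by
        refine tendsto_nhds_unique (hlim m) (tendsto_const_nhds.congr fun n => ?_)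
        by_contra hne
        obtain ⟨i, hi⟩ := isQLinear_expPoly (finite_latticeLT (F := F) t ω n) _ (Ne.symm hne)
        exact hm ⟨i, by dsimp only; omega⟩
      rw [h0, zero_mul, mul_zero]
    · simp only [Function.comp]
      conv_lhs => rw [← hpow k, Nat.add_sub_cancel, pow_succ]
      ring

/-- For k > 0 the terms tend to zero, so the ultrametric sum converges. For k = 0 the sum counts the
nonzero elements of V_n, and it equals -1 once V_n contains w: this is the convention E_0 = -1. -/
theorem tendsto_powerSum_latticeLT {t : C} {ω : Fin r → C} {w : C} {n₀ : ℕ}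
    (hw : w ∈ latticeLT F t ω n₀) (hw0 : w ≠ 0)
    (hL : ∀ R : ℝ, {x ∈ Set.range (latticeMap (F := F) t ω) | ‖x‖ ≤ R}.Finite) (k : ℕ) :
    Tendsto (fun n => ∑ v ∈ (finite_latticeLT (F := F) t ω n).toFinset.erase 0, (v ^ k)⁻¹) atTop
      (𝓝 (if k = 0 then -1 else
        ∑' l : {l : C // l ∈ Set.range (latticeMap (F := F) t ω) ∧ l ≠ 0}, (l.1 ^ k)⁻¹)) := by
  split_ifs with hk
  · refine tendsto_const_nhds.congr' ?_
    filter_upwards [eventually_ge_atTop n₀] with n hn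
    have h := natCast_card_toFinset_eq_zero (finite_latticeLT (F := F) t ω n)
      (latticeLT_mono t ω hn hw) hw0
    have h1 := card_erase_add_one (s := (finite_latticeLT (F := F) t ω n).toFinset) (a := 0)
      (by simp)
    rw [← h1, Nat.cast_add, Nat.cast_one] at h
    simp only [hk, pow_zero, inv_one, sum_const, nsmul_eq_mul, mul_one]
    exact (eq_neg_of_add_eq_zero_left h).symm
  · have hsum : Summable
        fun l : {l : C // l ∈ Set.range (latticeMap (F := F) t ω) ∧ l ≠ 0} => (l.1 ^ k)⁻¹ := by
      have := IsUltrametricDist.nonarchimedeanAddGroup (M := C)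
      refine NonarchimedeanAddGroup.summable_of_tendsto_cofinite_zero ?_
      have := (tendsto_inv_cofinite hL).pow k
      rw [zero_pow hk] at this
      simpa only [inv_pow] using this
    refine (hsum.hasSum.comp (tendsto_latticeFinset (F := F) t ω)).congr fun n => ?_
    rw [Function.comp, latticeFinset]
    exact sum_subtype_of_mem (fun l : C => (l ^ k)⁻¹) fun l hl => mem_range_and_ne_zero hl

end Limits

end Lattices

/-! ### The Drinfeld module as a limit -/

section DrinfeldModule

open Finset Polynomial Filter Topology
open scoped Classical

/-- As `a n 0 = 1`, the relation expresses `g n k` through the `g n i` with i < k and convergent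
quantities. -/
theorem exists_tendsto_of_twistedMul {F C : Type*} [Fintype F] [NormedField C]
    {g a : ℕ → ℕ → C} {α : ℕ → C} {c : ℕ → C}
    (ha0 : ∀ n, a n 0 = 1) (ha : ∀ k, Tendsto (fun n => a n k) atTop (𝓝 (α k)))
    (h : ∀ n k, c k * a (n + 1) k = twistedMul F (g n) (a n) k) :
    ∃ γ : ℕ → C, ∀ k, Tendsto (fun n => g n k) atTop (𝓝 (γ k)) := by
  suffices h : ∀ k, ∃ l, Tendsto (fun n => g n k) atTop (𝓝 l) from ⟨_, fun k => (h k).choose_spec⟩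
  intro k
  induction k using Nat.strong_induction_on with
  | _ k ih =>
    have hex : ∀ x ∈ (antidiagonal k).erase (k, 0), ∃ l,
        Tendsto (fun n => g n x.1 * a n x.2 ^ Fintype.card F ^ x.1) atTop (𝓝 l) := by
      intro x hx
      obtain ⟨hne, hx⟩ := mem_erase.1 hx
      rw [HasAntidiagonal.mem_antidiagonal] at hx
      have hlt : x.1 < k := by
        by_contra hge
        exact hne (Prod.ext (by dsimp only; omega) (by dsimp only; omega))
      obtain ⟨l, hl⟩ := ih x.1 hlt
      exact ⟨_, hl.mul ((ha x.2).pow _)⟩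
    choose! l hl using hex
    refine ⟨_, (((((ha k).comp (tendsto_add_atTop_nat 1)).const_mul (c k)).sub
      (tendsto_finsetSum _ hl))).congr fun n => ?_⟩
    have hmem : (k, 0) ∈ antidiagonal k := HasAntidiagonal.mem_antidiagonal.2 (add_zero k)
    rw [Function.comp, h, twistedMul, ← add_sum_erase _ _ hmem, add_sub_cancel_right, ha0, one_pow,
      mul_one]

variable {F C : Type*} [Field F] [Fintype F] [NormedField C] [Algebra F C] {r : ℕ}
  [IsUltrametricDist C]

local notation "q" => Fintype.card F

/-- Apply `exists_coeff_sup_span` to V_n inside t⁻¹V_{n+1}. That M does not depend on n is what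
keeps the top coefficient nonzero in the limit. -/
theorem exists_quotient_coeff {t : C} (ht : t ≠ 0) {ω : Fin r → C}
    (hinj : Function.Injective (latticeMap (F := F) t ω))
    (hL : ∀ R : ℝ, {x ∈ Set.range (latticeMap (F := F) t ω) | ‖x‖ ≤ R}.Finite) :
    ∃ M : ℝ, 0 ≤ M ∧ ∀ n, ∃ g : ℕ → C, (∀ i, r < i → g i = 0) ∧ 1 ≤ M * ‖g r‖ ∧
      ∀ k, t⁻¹ * t ^ q ^ k *
          (expPoly (finite_latticeLT (F := F) t ω (n + 1)).toFinset).coeff (q ^ k) =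
        twistedMul F g
          (fun k => (expPoly (finite_latticeLT (F := F) t ω n).toFinset).coeff (q ^ k)) k := by
  set L' := Set.range (latticeMap (F := F) t (t⁻¹ • ω)) with hL'def
  have hL' : ∀ R : ℝ, {x ∈ L' | ‖x‖ ≤ R}.Finite := fun R => by
    refine ((hL (‖t‖ * R)).preimage (f := fun x => t * x)
      (mul_right_injective₀ ht).injOn).subset ?_
    rintro _ ⟨⟨a, rfl⟩, ha⟩
    refine ⟨⟨a, by rw [latticeMap_smul]; exact (mul_inv_cancel_left₀ ht _).symm⟩, ?_⟩
    rw [norm_mul]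
    exact mul_le_mul_of_nonneg_left ha (norm_nonneg t)
  have hinj' : Function.Injective (latticeMap (F := F) t (t⁻¹ • ω)) := fun a b hab => by
    rw [latticeMap_smul, latticeMap_smul] at hab
    exact hinj (mul_left_cancel₀ (inv_ne_zero ht) hab)
  choose B hB0 hB using fun j : Fin r => exists_expPoly_eval_le hL' ((t⁻¹ • ω) j)
  set v : ℕ → C := fun j => if h : j < r then (t⁻¹ • ω) ⟨j, h⟩ else 0 with hv
  have hv_apply : ∀ j (h : j < r), v j = (t⁻¹ • ω) ⟨j, h⟩ := fun j h => dif_pos h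
  have hv_image : ∀ j (h : j < r), v '' Set.Iio j = (t⁻¹ • ω) '' Set.Iio ⟨j, h⟩ := by
    intro j h
    ext x
    constructor
    · rintro ⟨i, hi, rfl⟩
      have hi' : i < j := hi
      exact ⟨⟨i, hi'.trans h⟩, hi', (hv_apply i _).symm⟩
    · rintro ⟨i, hi, rfl⟩
      exact ⟨i, hi, hv_apply i i.2⟩
  have hv_range : v '' Set.Iio r = Set.range (t⁻¹ • ω) := by
    ext x
    constructor
    · rintro ⟨i, hi, rfl⟩
      exact ⟨⟨i, hi⟩, (hv_apply i _).symm⟩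
    · rintro ⟨i, rfl⟩
      exact ⟨i, i.2, hv_apply i i.2⟩
  -- The sum is a single bound dominating every `B j`.
  refine ⟨(∑ j, B j) ^ (q ^ r - 1), pow_nonneg (sum_nonneg fun j _ => hB0 j) _, fun n => ?_⟩
  have hsup : latticeLT F t ω n ⊔ Submodule.span F (v '' Set.Iio r) =
      latticeLT F t (t⁻¹ • ω) (n + 1) := by rw [hv_range, latticeLT_succ ht]
  have hfin : ((latticeLT F t ω n ⊔ Submodule.span F (v '' Set.Iio r) : Submodule F C) :
      Set C).Finite := by
    rw [hsup]
    exact finite_latticeLT t _ _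
  obtain ⟨g, -, hg, hgM, hgk⟩ := exists_coeff_sup_span v (M := ∑ j, B j) r hfin
    (fun j hj => by
      rw [hv_apply j hj, hv_image j hj]
      exact notMem_latticeLT_sup_span ht hinj' n ⟨j, hj⟩)
    (fun U hU hUle j hj => by
      rw [hv_apply j hj]
      refine (hB ⟨j, hj⟩ hU.toFinset fun x hx => ?_).trans
        (single_le_sum (f := B) (fun i _ => hB0 i) (mem_univ _))
      rw [Set.Finite.coe_toFinset] at hx
      exact mem_range_of_mem_latticeLT (F := F) (n := n + 1) (hsup ▸ hUle hx))
    (finite_latticeLT t ω n)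
  refine ⟨g, hg, hgM, fun k => ?_⟩
  rw [twistedMul, ← hgk k]
  symm
  refine expPoly_coeff_smul ht (by simp) (fun x => ?_) _
  rw [Set.Finite.mem_toFinset, Set.Finite.mem_toFinset, SetLike.mem_coe, SetLike.mem_coe, hsup]
  exact mem_latticeLT_smul ht

variable [CompleteSpace C]

theorem exists_ne_zero_of_discrete {t : C} (ht : t ≠ 0) {ω : Fin r → C} (hr : 1 ≤ r)
    (hinj : Function.Injective (latticeMap (F := F) t ω))
    (hL : ∀ R : ℝ, {x ∈ Set.range (latticeMap (F := F) t ω) | ‖x‖ ≤ R}.Finite) (m : ℕ) :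
    (∃ i ∈ Icc m (m + r - 1), (if q ^ i - 1 = 0 then -1 else
      ∑' l : {l : C // l ∈ Set.range (latticeMap (F := F) t ω) ∧ l ≠ 0},
        (l.1 ^ (q ^ i - 1))⁻¹) ≠ 0) ∧
    ∃ α : ℕ → C, (∀ z, HasSum (fun i => α i * z ^ q ^ i)
      (z * ∏' l : {l : C // l ∈ Set.range (latticeMap (F := F) t ω) ∧ l ≠ 0}, (1 - z / l.1))) ∧
        ∃ i ∈ Icc m (m + r - 1), α i ≠ 0 := by
  obtain ⟨α, hα, hexp⟩ := exists_exp_coeff t ω hL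
  have ha0 : ∀ n,
      (expPoly (finite_latticeLT (F := F) t ω n).toFinset).coeff (q ^ 0) = 1 := fun n => by
    rw [pow_zero, expPoly_coeff_one]
  have hα0 : α 0 = 1 :=
    tendsto_nhds_unique (hα 0) (tendsto_const_nhds.congr fun n => (ha0 n).symm)
  obtain ⟨M, hM0, hM⟩ := exists_quotient_coeff ht hinj hL
  choose g hg hgM hgk using hM
  obtain ⟨γ, hγ⟩ := exists_tendsto_of_twistedMul (F := F) (c := fun k => t⁻¹ * t ^ q ^ k)
    (a := fun n k => (expPoly (finite_latticeLT (F := F) t ω n).toFinset).coeff (q ^ k))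
    ha0 hα hgk
  have hγ0 : ∀ i, r < i → γ i = 0 := fun i hi =>
    tendsto_nhds_unique (hγ i) (tendsto_const_nhds.congr fun n => (hg n i hi).symm)
  have hγr : γ r ≠ 0 := by
    intro h0
    have h1 : 1 ≤ M * ‖γ r‖ :=
      ge_of_tendsto ((hγ r).norm.const_mul M) (Eventually.of_forall fun n => hgM n)
    rw [h0, norm_zero, mul_zero] at h1
    exact absurd h1 (by norm_num)
  have hrel : ∀ k, t⁻¹ * t ^ q ^ k * α k = twistedMul F γ α k := fun k => by
    refine tendsto_nhds_unique
      (((hα k).comp (tendsto_add_atTop_nat 1)).const_mul (t⁻¹ * t ^ q ^ k)) ?_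
    refine Tendsto.congr (fun n => (hgk n k).symm) ?_
    exact tendsto_finsetSum _ fun x _ => (hγ x.1).mul ((hα x.2).pow _)
  refine ⟨?_, α, hexp, exists_ne_zero_of_twistedMul_left hr (by rw [hα0]; exact one_ne_zero)
    hγ0 hγr hrel m⟩
  set ε : ℕ → C := fun i => if q ^ i - 1 = 0 then -1 else
      ∑' l : {l : C // l ∈ Set.range (latticeMap (F := F) t ω) ∧ l ≠ 0},
        (l.1 ^ (q ^ i - 1))⁻¹ with hεdef
  have hw0 : latticeMap t ω (Pi.single ⟨0, hr⟩ (1 : F[X])) ≠ 0 := by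
    rw [← map_zero (latticeMap (F := F) t ω), Ne, hinj.eq_iff]
    simp
  obtain ⟨n₀, hw⟩ := exists_mem_latticeLT t ω (Pi.single ⟨0, hr⟩ (1 : F[X]))
  have hε := fun i => tendsto_powerSum_latticeLT hw hw0 hL (q ^ i - 1)
  have hε0 : ε 0 = -1 := by simp [hεdef]
  have hinv : ∀ k, k ≠ 0 → twistedMul F α ε k = 0 := fun k hk => by
    refine tendsto_nhds_unique
      (tendsto_finsetSum _ fun x _ => (hα x.1).mul ((hε x.2).pow (q ^ x.1))) ?_
    refine tendsto_const_nhds.congr' ?_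
    filter_upwards [eventually_ge_atTop n₀] with n hn
    exact (sum_coeff_mul_powerSum_pow (finite_latticeLT (F := F) t ω n)
      (latticeLT_mono t ω hn hw) hw0 hk).symm
  -- tγ is the Drinfeld module: its constant coefficient absorbs the factor t⁻¹ in `hrel`.
  have hφ : ∀ k, t ^ q ^ k * α k = twistedMul F (fun i => t * γ i) α k := fun k => by
    have : twistedMul F (fun i => t * γ i) α k = t * twistedMul F γ α k := by
      simp only [twistedMul, mul_sum, mul_assoc]
    rw [this, ← hrel, ← mul_assoc, mul_inv_cancel_left₀ ht]
  refine exists_ne_zero_of_twistedMul_right (F := F) (φ := fun i => t * γ i) hr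
    (by rw [hε0]; exact neg_ne_zero.2 one_ne_zero) (fun i hi => by simp [hγ0 i hi])
    (mul_ne_zero ht hγr)
    (twistedMul_eq_mul_of_inverse hα0 hφ (by simp [twistedMul, hα0, hε0]) hinv) m

end DrinfeldModule

/-! ### Discreteness of the lattice in C_∞ and conclusion -/

section Discreteness

open Polynomial

variable (F : Type*) [Field F] [Fintype F]

local notation "q" => Fintype.card F

instance isUltrametricDistCInfty : IsUltrametricDist (CInfty F) :=
  IsUltrametricDist.of_normedAlgebra (KInfty F)

theorem polyToKInfty_X (F : Type*) [Field F] : polyToKInfty F X = elemT F := by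
  simp [polyToKInfty]

/-- A nonzero constant is a root of unity. -/
theorem norm_polyToKInfty_C_le (c : F) : ‖polyToKInfty F (Polynomial.C c)‖ ≤ 1 := by
  by_cases hc : c = 0
  · simp [hc]
  · have h : polyToKInfty F (Polynomial.C c) ^ (q - 1) = 1 := by
      rw [← map_pow, ← map_pow, FiniteField.pow_card_sub_one_eq_one c hc, map_one, map_one]
    have h1 : ‖polyToKInfty F (Polynomial.C c)‖ ^ (q - 1) = 1 := by rw [← norm_pow, h, norm_one]
    have hq : 1 < q := Fintype.one_lt_card
    exact ((pow_eq_one_iff_of_nonneg (norm_nonneg _) (by omega)).1 h1).le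

/-- Removing the constant term and a factor X lowers the degree by one; the constant has norm at
most 1 and is dominated. -/
theorem card_pow_natDegree_le_norm {p : F[X]} (hp : p ≠ 0) :
    (q : ℝ) ^ p.natDegree ≤ ‖polyToKInfty F p‖ := by
  have hq : (1 : ℝ) < q := by exact_mod_cast Fintype.one_lt_card
  induction hn : p.natDegree generalizing p with
  | zero =>
    obtain ⟨c, rfl⟩ := natDegree_eq_zero.1 hn
    have hc : c ≠ 0 := fun h => hp (by rw [h, map_zero])
    have h1 := norm_polyToKInfty_C_le F c⁻¹
    have h2 : ‖polyToKInfty F (Polynomial.C c)‖ * ‖polyToKInfty F (Polynomial.C c⁻¹)‖ = 1 := by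
      rw [← norm_mul, ← map_mul, ← map_mul, mul_inv_cancel₀ hc, map_one, map_one, norm_one]
    rw [pow_zero, ← h2]
    exact mul_le_of_le_one_right (norm_nonneg _) h1
  | succ n ih =>
    have hdiv : p.divX.natDegree = n := by
      rw [natDegree_divX_eq_natDegree_tsub_one, hn, Nat.add_sub_cancel]
    have hdiv0 : p.divX ≠ 0 := fun h => by
      have := divX_mul_X_add p
      rw [h, zero_mul, zero_add] at this
      rw [← this, natDegree_C] at hn
      omega
    have h := ih hdiv0 hdiv
    have hT : ‖polyToKInfty F (p.divX * X)‖ = ‖polyToKInfty F p.divX‖ * q := by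
      rw [map_mul, norm_mul, polyToKInfty_X, norm_elemT]
    have hpow : (q : ℝ) ^ (n + 1) ≤ ‖polyToKInfty F (p.divX * X)‖ := by
      rw [hT, pow_succ]
      exact mul_le_mul_of_nonneg_right h (by positivity)
    have hlt : ‖polyToKInfty F (Polynomial.C (p.coeff 0))‖ < ‖polyToKInfty F (p.divX * X)‖ :=
      (norm_polyToKInfty_C_le F _).trans_lt ((one_lt_pow₀ hq n.succ_ne_zero).trans_le hpow)
    have heq : ‖polyToKInfty F p‖ = ‖polyToKInfty F (p.divX * X)‖ := by
      conv_lhs => rw [← divX_mul_X_add p, map_add]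
      rw [IsUltrametricDist.norm_add_eq_max_of_norm_ne_norm hlt.ne', max_eq_left hlt.le]
    rw [heq]
    exact hpow

theorem polyToKInfty_injective : Function.Injective (polyToKInfty F) := by
  rw [injective_iff_map_eq_zero]
  intro p hp
  by_contra h
  have h1 := card_pow_natDegree_le_norm F h
  rw [hp, norm_zero] at h1
  have hq : (0 : ℝ) < q := by exact_mod_cast Fintype.card_pos
  exact absurd h1 (not_le.2 (pow_pos hq _))

theorem finite_norm_polyToKInfty_le (R : ℝ) : {p : F[X] | ‖polyToKInfty F p‖ ≤ R}.Finite := by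
  have hq : (1 : ℝ) < q := by exact_mod_cast Fintype.one_lt_card
  obtain ⟨n, hn⟩ := pow_unbounded_of_one_lt R hq
  have : Finite (degreeLT F n) := (degreeLTEquiv F n).toEquiv.finite_iff.2 inferInstance
  refine (Set.toFinite ((degreeLT F n : Submodule F F[X]) : Set F[X])).subset fun p hp => ?_
  rw [SetLike.mem_coe, mem_degreeLT]
  by_cases h0 : p = 0
  · rw [h0, degree_zero]
    exact WithBot.bot_lt_coe _
  · rw [degree_eq_natDegree h0]
    have h := ((card_pow_natDegree_le_norm F h0).trans hp).trans_lt hn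
    exact_mod_cast (pow_lt_pow_iff_right₀ hq).1 h

variable {F} {r : ℕ}

theorem sum_polyToCInfty_mul (ω : Fin r → CInfty F) (a : Fin r → F[X]) :
    ∑ j, polyToCInfty F (a j) * ω j =
      Fintype.linearCombination (KInfty F) ω fun j => polyToKInfty F (a j) := by
  rw [Fintype.linearCombination_apply]
  refine Finset.sum_congr rfl fun j _ => ?_
  rw [Algebra.smul_def]
  rfl

theorem sum_polyToCInfty_mul_injective {ω : Fin r → CInfty F}
    (hω : LinearIndependent (KInfty F) ω) :
    Function.Injective fun a : Fin r → F[X] => ∑ j, polyToCInfty F (a j) * ω j := by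
  intro a b hab
  simp only [sum_polyToCInfty_mul] at hab
  have := linearIndependent_iff_injective_fintypeLinearCombination.1 hω hab
  funext j
  exact polyToKInfty_injective F (congrFun this j)

/-- An injective K_∞-linear map from K_∞^r is antilipschitz, so a bounded lattice vector has bounded
coefficients in A, and there are finitely many of these. -/
theorem finite_lattice_norm_le {ω : Fin r → CInfty F} (hω : LinearIndependent (KInfty F) ω)
    (R : ℝ) : {x ∈ lattice ω | ‖x‖ ≤ R}.Finite := by
  obtain ⟨K, -, hK⟩ := LinearMap.exists_antilipschitzWith
    (Fintype.linearCombination (KInfty F) ω)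
    (LinearMap.ker_eq_bot.2 (linearIndependent_iff_injective_fintypeLinearCombination.1 hω))
  have hfin : {a : Fin r → F[X] | ∀ j, ‖polyToKInfty F (a j)‖ ≤ K * R}.Finite :=
    Set.Finite.pi' fun _ => finite_norm_polyToKInfty_le F _
  refine (hfin.image fun a => ∑ j, polyToCInfty F (a j) * ω j).subset ?_
  rintro _ ⟨⟨a, rfl⟩, ha⟩
  refine ⟨a, fun j => ?_, rfl⟩
  dsimp only at ha
  rw [sum_polyToCInfty_mul] at ha
  have h := hK.le_mul_dist (fun j => polyToKInfty F (a j)) 0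
  rw [map_zero, dist_zero_right, dist_zero_right] at h
  exact (norm_le_pi_norm (fun j => polyToKInfty F (a j)) j).trans
    (h.trans (mul_le_mul_of_nonneg_left ha K.2))

theorem exists_eisenstein_and_paraEisenstein_ne_zero {ω : Fin r → CInfty F} (hr : 1 ≤ r)
    (hω : LinearIndependent (KInfty F) ω) (m : ℕ) :
    (∃ i ∈ Finset.Icc m (m + r - 1), eisenstein (q ^ i - 1) ω ≠ 0) ∧
      ∃ i ∈ Finset.Icc m (m + r - 1), paraEisenstein i ω ≠ 0 := by
  -- This F-structure makes `aeval t` agree with `polyToCInfty`.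
  let _ : Algebra F (CInfty F) := ((polyToCInfty F).comp Polynomial.C).toAlgebra
  set t : CInfty F := polyToCInfty F X with ht
  have ht0 : t ≠ 0 := by
    rw [ht, polyToCInfty, RingHom.comp_apply, Ne, map_eq_zero,
      map_eq_zero_iff _ (polyToKInfty_injective F)]
    exact X_ne_zero
  have haeval : ∀ p : F[X], aeval t p = polyToCInfty F p := fun p => by
    have : (aeval t : F[X] →ₐ[F] CInfty F).toRingHom = polyToCInfty F :=
      Polynomial.ringHom_ext (fun a => aeval_C t a) (aeval_X t)
    exact congrArg (fun f : F[X] →+* CInfty F => f p) this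
  have hmap : ∀ a : Fin r → F[X], latticeMap t ω a = ∑ j, polyToCInfty F (a j) * ω j := fun a => by
    simp only [latticeMap_apply, haeval]
  have hrange : Set.range (latticeMap (F := F) t ω) = lattice ω := by
    rw [lattice, ← funext hmap]
  obtain ⟨hE, α, hα, hne⟩ := exists_ne_zero_of_discrete (F := F) ht0 hr
    (by rw [funext hmap]; exact sum_polyToCInfty_mul_injective hω)
    (by rw [hrange]; exact finite_lattice_norm_le hω) m
  rw [hrange] at hE hα
  refine ⟨hE, ?_⟩
  have hex : ∃ a, IsExpExpansion ω a := ⟨α, hα⟩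
  have hpara : ∀ i, paraEisenstein i ω = α i := fun i => by
    rw [paraEisenstein, dif_pos hex, hex.choose_spec.unique hα]
  simpa only [hpara] using hne

end Discreteness

end DrinfeldModular

end

/-- For `r ≥ 2`, any point `(ω₁ : ⋯ : ω_r)` of the Drinfeld symmetric space `Ω^r`, and any `r`
consecutive natural numbers `m, …, m + r - 1`, at least one of the `E_{q^i - 1}(ω)` and at least one
of the `α_i(ω)` with `i` among these numbers is nonzero. -/
theorem proposition3p3 (F : Type*) [Field F] [Fintype F] (r : ℕ) (hr : 2 ≤ r)
    (ω : Fin r → DrinfeldModular.CInfty F) (hω : ω ≠ 0)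
    (hΩ : Projectivization.mk (DrinfeldModular.CInfty F) ω hω ∈ DrinfeldModular.Omega F r)
    (m : ℕ) :
    (∃ i ∈ Finset.Icc m (m + r - 1),
      DrinfeldModular.eisenstein (Fintype.card F ^ i - 1) ω ≠ 0) ∧
    (∃ i ∈ Finset.Icc m (m + r - 1), DrinfeldModular.paraEisenstein i ω ≠ 0) :=
  DrinfeldModular.exists_eisenstein_and_paraEisenstein_ne_zero (by omega)
    ((DrinfeldModular.mk_mem_Omega_iff ω hω).1 hΩ) m
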